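/- **Setting.** Let $1\le k<n$, let $A,B\in\mathbb R^{n\times n}$ be symmetric with $B\succeq 0$ and $\operatorname{rank}(B)>n-k$, let $D\in\mathbb R^{n\times k}$ and $0\le\theta\le 1$. Put $\mathbb O^{m\times l}=\{X\in\mathbb R^{m\times l}: X^{\rm T}X=I_l\}$, and for $X\in\mathbb O^{n\times k}$ $$f_\theta(X)=\frac{\operatorname{tr}(X^{\rm T}AX+X^{\rm T}D)}{[\operatorname{tr}(X^{\rm T}BX)]^\theta},\qquad E(X)=\frac{2}{[\operatorname{tr}(X^{\rm T}BX)]^\theta}\Big[A+\tfrac12(DX^{\rm T}+XD^{\rm T})-\theta f_1(X)B\Big].$$ Eigenvalues $\lambda_1\ge\dots\ge\lambda_n$ of symmetric matrices and singular values are in nonincreasing order, with multiplicity; $\mathcal R(X)$ is the column space and $\|\cdot\|_2$ the spectral norm. For $X,Y\in\mathbb O^{n\times k}$ the distance of $\mathcal R(X)$ and $\mathcal R(Y)$ is $\|\sin\Theta\|_2$, $\Theta=\operatorname{diag}(\theta_1,\dots,\theta_k)$, $\theta_i=\arccos\sigma_i(X^{\rm T}Y)$. **SCF iteration.** $X_0\in\mathbb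 O^{n\times k}$, with $\operatorname{tr}(X_0^{\rm T}AX_0+X_0^{\rm T}D)\ge0$ if $0<\theta<1$. For $i=1,2,\dots$: let $E_i=E(X_{i-1})$; choose $\widehat X_i\in\mathbb O^{n\times k}$ whose columns are orthonormal eigenvectors of $E_i$ for its $k$ largest eigenvalues, or simply some $\widehat X_i\in\mathbb O^{n\times k}$ with $\operatorname{tr}(\widehat X_i^{\rm T}E_i\widehat X_i)>\operatorname{tr}(X_{i-1}^{\rm T}E_iX_{i-1})$; take an SVD $\widehat X_i^{\rm T}D=U_i\Sigma_iV_i^{\rm T}$ and set $X_i=\widehat X_iU_iV_i^{\rm T}$. **Theorem.** Let $\{X_i\}_{i\ge0}$ be generated by the SCF iteration, where, if $\widehat X_i$ is not always an exact eigenbasis for the $k$ largest eigenvalues, the eigen-decompositions become asymptotically accurate: $\sum_{j=1}^k\lambda_j(E_i)-\operatorname{tr}(\widehat X_i^{\rm T}E_i\widehat X_i)\to0$ (this difference is $0$ for an exact eigenbasis). Let $X_*$ be an accumulation point of $\{X_i\}$. Suppose that $\mathcal R(X_*)$ is an isolated accumulation point of $\{\mathcal R(X_i)\}$ in the $\sin\Theta$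 metric and that $\lambda_k(E(X_*))>\lambda_{k+1}(E(X_*))$. Let $r=\operatorname{rank}(X_*^{\rm T}D)$. (a) The entire sequence $\{\mathcal R(X_i)\}$ converges to $\mathcal R(X_*)$ in the $\sin\Theta$ metric. (b) If $r=k$, then $X_i\to X_*$. (c) In general, $X_*^{\rm T}D\succeq0$, so it has an SVD of the form $X_*^{\rm T}D=V\Sigma V^{\rm T}$; and for every such SVD (singular values in nonincreasing order), with $V_1=V_{(:,1:r)}$ and $V_2=V_{(:,r+1:k)}$, the set $$\mathbb X_*=\{X_*V_1V_1^{\rm T}+X_*V_2WV_2^{\rm T}\,:\,W\in\mathbb O^{(k-r)\times(k-r)}\}$$ is the set of all maximizers of $f_\theta$ over $\{X\in\mathbb O^{n\times k}:\mathcal R(X)=\mathcal R(X_*)\}$, and $\min_{X\in\mathbb X_*}\|X_i-X\|_2\to0$ as $i\to\infty$ (the minimum being attained). For $r=k$ the term with $W$ is absent. -/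

import Mathlib

open Matrix Filter Topology
open scoped Matrix.Norms.L2Operator

noncomputable section

namespace TraceRatio

/-- Matrices with orthonormal columns: `𝕆^{m × l} = {X : Xᵀ X = I}`. -/
def stiefel (m l : Type*) [Fintype m] [DecidableEq l] : Set (Matrix m l ℝ) :=
  {X | Xᵀ * X = 1}

/-- The column space `ℛ(X)`. -/
def colSpace {m l : Type*} [Fintype l] (X : Matrix m l ℝ) : Submodule ℝ (m → ℝ) :=
  LinearMap.range X.mulVecLin

section Objective

variable {n k : ℕ}

/-- The objective `f_θ(X) = tr(XᵀAX + XᵀD) / [tr(XᵀBX)]^θ`. -/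
def f (A B : Matrix (Fin n) (Fin n) ℝ) (D : Matrix (Fin n) (Fin k) ℝ) (θ : ℝ)
    (X : Matrix (Fin n) (Fin k) ℝ) : ℝ :=
  trace (Xᵀ * A * X + Xᵀ * D) / trace (Xᵀ * B * X) ^ θ

/-- `E(X) = 2 / [tr(XᵀBX)]^θ · [A + (D Xᵀ + X Dᵀ)/2 - θ f₁(X) B]`. -/
def E (A B : Matrix (Fin n) (Fin n) ℝ) (D : Matrix (Fin n) (Fin k) ℝ) (θ : ℝ)
    (X : Matrix (Fin n) (Fin k) ℝ) : Matrix (Fin n) (Fin n) ℝ :=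
  (2 / trace (Xᵀ * B * X) ^ θ) •
    (A + (1 / 2 : ℝ) • (D * Xᵀ + X * Dᵀ) - (θ * f A B D 1 X) • B)

/-- `E(X)` is symmetric whenever `A` and `B` are. -/
theorem E_isHermitian {A B : Matrix (Fin n) (Fin n) ℝ} (hA : A.IsSymm) (hB : B.IsSymm)
    (D : Matrix (Fin n) (Fin k) ℝ) (θ : ℝ) (X : Matrix (Fin n) (Fin k) ℝ) :
    (E A B D θ X).IsHermitian := by
  have hA' : Aᵀ = A := hA
  have hB' : Bᵀ = B := hB
  rw [Matrix.IsHermitian, conjTranspose_eq_transpose_of_trivial]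
  simp [E, transpose_mul, hA', hB', add_comm]

end Objective

section Eigenvalues

variable {n k : ℕ}

/-- Eigenvalues of a real symmetric matrix, counted with multiplicity and in nonincreasing order
(zero-based: `eig M 0` is the largest one). Only used for symmetric `M`. -/
def eig (M : Matrix (Fin n) (Fin n) ℝ) (j : Fin n) : ℝ :=
  open scoped Classical in
  if h : M.IsHermitian then h.eigenvalues₀ (Fin.cast (Fintype.card_fin n).symm j) else 0

/-- The columns of `Y` are orthonormal eigenvectors of `M` for its `k` largest eigenvalues. -/
def IsTopEigenbasis (hk : k ≤ n) (M : Matrix (Fin n) (Fin n) ℝ)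
    (Y : Matrix (Fin n) (Fin k) ℝ) : Prop :=
  Y ∈ stiefel (Fin n) (Fin k) ∧
    M * Y = Y * diagonal (fun j : Fin k => eig M (Fin.castLE hk j))

/-- The accuracy of `Y` as an approximate eigenbasis for the `k` largest eigenvalues of `M`:
the sum of these eigenvalues minus `tr(YᵀMY)`. -/
def topTraceDefect (hk : k ≤ n) (M : Matrix (Fin n) (Fin n) ℝ)
    (Y : Matrix (Fin n) (Fin k) ℝ) : ℝ :=
  (∑ j : Fin k, eig M (Fin.castLE hk j)) - trace (Yᵀ * M * Y)

/-- The defect of an exact eigenbasis is zero. -/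
theorem IsTopEigenbasis.topTraceDefect_eq_zero {hk : k ≤ n} {M : Matrix (Fin n) (Fin n) ℝ}
    {Y : Matrix (Fin n) (Fin k) ℝ} (h : IsTopEigenbasis hk M Y) :
    topTraceDefect hk M Y = 0 := by
  have h1 : Yᵀ * Y = 1 := h.1
  rw [topTraceDefect, Matrix.mul_assoc, h.2, ← Matrix.mul_assoc, h1, Matrix.one_mul,
    trace_diagonal, sub_self]

end Eigenvalues

section SVD

variable {k : ℕ}

/-- `S = U diag(σ) Vᵀ` is a singular value decomposition of the square matrix `S`, with the
singular values in nonincreasing order. -/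
structure IsSVD (S U : Matrix (Fin k) (Fin k) ℝ) (σ : Fin k → ℝ)
    (V : Matrix (Fin k) (Fin k) ℝ) : Prop where
  left_mem : U ∈ stiefel (Fin k) (Fin k)
  right_mem : V ∈ stiefel (Fin k) (Fin k)
  nonneg : ∀ j, 0 ≤ σ j
  antitone : Antitone σ
  eq : S = U * diagonal σ * Vᵀ

end SVD

section SCF

variable {n k : ℕ}

/-- `X 0, X 1, …` is a sequence of SCF iterates, with intermediate matrices
`Xhat 1, Xhat 2, …` (the entry `Xhat 0` is not used). At each step `Xhat (i + 1)` is either an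
orthonormal eigenbasis of `E(X i)` for its `k` largest eigenvalues, or some matrix with orthonormal
columns that strictly increases the trace; then, for an SVD `Xhat (i + 1)ᵀ D = U Σ Vᵀ`,
the next iterate is `X (i + 1) = Xhat (i + 1) U Vᵀ`. -/
structure IsSCF (hk : k ≤ n) (A B : Matrix (Fin n) (Fin n) ℝ) (D : Matrix (Fin n) (Fin k) ℝ)
    (θ : ℝ) (X Xhat : ℕ → Matrix (Fin n) (Fin k) ℝ) : Prop where
  init_mem : X 0 ∈ stiefel (Fin n) (Fin k)
  init_nonneg : 0 < θ → θ < 1 → 0 ≤ trace ((X 0)ᵀ * A * X 0 + (X 0)ᵀ * D)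
  step : ∀ i, IsTopEigenbasis hk (E A B D θ (X i)) (Xhat (i + 1)) ∨
    (Xhat (i + 1) ∈ stiefel (Fin n) (Fin k) ∧
      trace ((X i)ᵀ * E A B D θ (X i) * X i) <
        trace ((Xhat (i + 1))ᵀ * E A B D θ (X i) * Xhat (i + 1)))
  next : ∀ i, ∃ U σ V, IsSVD ((Xhat (i + 1))ᵀ * D) U σ V ∧ X (i + 1) = Xhat (i + 1) * U * Vᵀ

end SCF

section Grassmann

variable {n k : ℕ}

/-- The canonical angles `θ_i = arccos σ_i(XᵀY)` between the column spaces of `X` and `Y`, where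
`X` and `Y` have orthonormal columns. -/
def canonicalAngle (X Y : Matrix (Fin n) (Fin k) ℝ) (i : Fin k) : ℝ :=
  Real.arccos ((Matrix.toEuclideanLin (Xᵀ * Y)).singularValues i)

/-- The distance `‖sin Θ(ℛ(X), ℛ(Y))‖₂` (spectral norm) between the column spaces of `X` and `Y`,
where `X` and `Y` have orthonormal columns. -/
def sinThetaDist (X Y : Matrix (Fin n) (Fin k) ℝ) : ℝ :=
  ‖diagonal (fun i : Fin k => Real.sin (canonicalAngle X Y i))‖

/-- `ℛ(Y)` is an accumulation point of the sequence of subspaces `ℛ(X i)` in the `sin Θ` metric. -/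
def IsAccSubspace (X : ℕ → Matrix (Fin n) (Fin k) ℝ) (Y : Matrix (Fin n) (Fin k) ℝ) : Prop :=
  ∀ ε > 0, ∃ᶠ i in atTop, sinThetaDist (X i) Y < ε

/-- `ℛ(Y)` is an isolated accumulation point of the sequence of subspaces `ℛ(X i)` in the `sin Θ`
metric. The points of the Grassmannian are given by orthonormal basis matrices. -/
def IsIsolatedAccSubspace (X : ℕ → Matrix (Fin n) (Fin k) ℝ)
    (Y : Matrix (Fin n) (Fin k) ℝ) : Prop :=
  IsAccSubspace X Y ∧ ∃ δ > 0, ∀ Z ∈ stiefel (Fin n) (Fin k),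
    IsAccSubspace X Z → sinThetaDist Z Y < δ → colSpace Z = colSpace Y

end Grassmann

section LimitSet

variable {n k : ℕ}

/-- The columns `1, …, r` of `V`. -/
def firstCols (V : Matrix (Fin k) (Fin k) ℝ) (r : ℕ) :
    Matrix (Fin k) {j : Fin k // (j : ℕ) < r} ℝ :=
  V.submatrix id Subtype.val

/-- The columns `r + 1, …, k` of `V`. -/
def lastCols (V : Matrix (Fin k) (Fin k) ℝ) (r : ℕ) :
    Matrix (Fin k) {j : Fin k // r ≤ (j : ℕ)} ℝ :=
  V.submatrix id Subtype.val

/-- The set `{Xs V₁ V₁ᵀ + Xs V₂ W V₂ᵀ : W orthogonal of order k - r}`, where `V₁` consists of the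
first `r` columns of `V` and `V₂` of the last `k - r` columns. -/
def limitSet (Xs : Matrix (Fin n) (Fin k) ℝ) (V : Matrix (Fin k) (Fin k) ℝ) (r : ℕ) :
    Set (Matrix (Fin n) (Fin k) ℝ) :=
  {Y | ∃ W ∈ stiefel {j : Fin k // r ≤ (j : ℕ)} {j : Fin k // r ≤ (j : ℕ)},
    Y = Xs * firstCols V r * (firstCols V r)ᵀ + Xs * lastCols V r * W * (lastCols V r)ᵀ}

/-- The orthonormal basis matrices of the column space of `Xs`. -/
def orthonormalBases (Xs : Matrix (Fin n) (Fin k) ℝ) : Set (Matrix (Fin n) (Fin k) ℝ) :=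
  {Y ∈ stiefel (Fin n) (Fin k) | colSpace Y = colSpace Xs}

end LimitSet

end TraceRatio

end

open TraceRatio

namespace TraceRatio

/-! The alignment by `U * Vᵀ` makes each later iterate satisfy `YᵀD ⪰ 0`. For such `Y`, a trace
inequality for semidefinite matrices and Bernoulli's inequality (with the sign of the numerator when
`0 < θ < 1`) show that a gain `T` of `tr(YᵀE(X)Y)` over `tr(XᵀE(X)X)` raises `f` by at least a
positive multiple of `T` (`ascent_step`). As `f` is bounded on a compact set, the gains tend to
zero. With asymptotically accurate eigenbases, the iterates themselves then asymptotically attain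
the sum of the top `k` eigenvalues of `E(X i)`. Hence every accumulation point `Z` maximizes the
trace for its own `E(Z)`, and `ZᵀD ⪰ 0`.

The eigenvalue gap is assumed only at `Xs`, whereas iterates whose spans approach that of `Xs` may
accumulate at some `Xs * Q`. Semidefiniteness of both `XsᵀD` and `QᵀXsᵀD` forces `Q` to fix `XsᵀD`,
and invariance of the common span then gives `E(Xs * Q) = E(Xs)` (`E_mul_eq_of_comm`). So the gap
applies at `Xs * Q` too, and the next eigenbases also accumulate only at bases of the span of `Xs`.
Since that span is isolated, the sequence of subspaces cannot leave a small ball once it has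
entered, which gives convergence.

Once the subspaces converge, every accumulation point of the iterates is `Xs * Q` with `Q` fixing
`XsᵀD`. These matrices are both the limit set and the maximizers of `f` over the bases of that span;
compactness gives convergence in distance, and full rank leaves only `Q = 1`. -/

theorem isClosed_stiefel {m l : Type*} [Fintype m] [DecidableEq l] : IsClosed (stiefel m l) :=
  isClosed_eq (by fun_prop) continuous_const

theorem isCompact_stiefel {m l : Type*} [Fintype m] [DecidableEq l] :
    IsCompact (stiefel m l) := by
  have : IsCompact (Set.univ.pi fun _ : m => Set.univ.pi fun _ : l => Set.Icc (-1 : ℝ) 1) :=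
    isCompact_univ_pi fun _ => isCompact_univ_pi fun _ => isCompact_Icc
  refine this.of_isClosed_subset isClosed_stiefel ?_
  intro (X : Matrix m l ℝ) hX i _ j _
  have h : (Xᵀ * X) j j = 1 := by rw [show Xᵀ * X = 1 from hX]; simp
  have h1 : X i j ^ 2 ≤ 1 := by
    rw [← h, mul_apply]
    simp only [transpose_apply, ← sq]
    exact Finset.single_le_sum (f := fun i => X i j ^ 2) (fun _ _ => sq_nonneg _)
      (Finset.mem_univ i)
  exact abs_le.mp ((sq_le_one_iff_abs_le_one _).mp h1)

/-! ### Trace inequalities for semidefinite matrices and their equality cases. -/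

section Stiefel

variable {m l : Type*} [Fintype m] [Fintype l] [DecidableEq l]

theorem mul_mem_stiefel {X : Matrix m l ℝ} (hX : X ∈ stiefel m l) {Q : Matrix l l ℝ}
    (hQ : Q ∈ stiefel l l) : X * Q ∈ stiefel m l := by
  have h1 : Xᵀ * X = 1 := hX
  have h2 : Qᵀ * Q = 1 := hQ
  change (X * Q)ᵀ * (X * Q) = 1
  rw [transpose_mul, Matrix.mul_assoc, ← Matrix.mul_assoc Xᵀ, h1, Matrix.one_mul, h2]

theorem mul_transpose_eq_one_of_mem_stiefel {Q : Matrix l l ℝ} (hQ : Q ∈ stiefel l l) :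
    Q * Qᵀ = 1 :=
  mul_eq_one_comm.mp hQ

theorem transpose_mem_stiefel {Q : Matrix l l ℝ} (hQ : Q ∈ stiefel l l) : Qᵀ ∈ stiefel l l := by
  change Qᵀᵀ * Qᵀ = 1
  rw [transpose_transpose, mul_transpose_eq_one_of_mem_stiefel hQ]

/-- The identity `tr((X - Y) T (X - Y)ᵀ) = 2 (tr T - tr(XᵀYT))` for symmetric `T`. -/
theorem trace_sub_mul_mul_transpose_sub {X Y : Matrix m l ℝ} (hX : X ∈ stiefel m l)
    (hY : Y ∈ stiefel m l) {T : Matrix l l ℝ} (hT : Tᵀ = T) :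
    trace ((X - Y) * T * (X - Y)ᵀ) = 2 * (trace T - trace (Xᵀ * Y * T)) := by
  have h1 : Xᵀ * X = 1 := hX
  have h2 : Yᵀ * Y = 1 := hY
  have e1 : trace (X * T * Xᵀ) = trace T := by
    rw [trace_mul_cycle, h1, Matrix.one_mul]
  have e2 : trace (Y * T * Yᵀ) = trace T := by
    rw [trace_mul_cycle, h2, Matrix.one_mul]
  have e3 : trace (Y * T * Xᵀ) = trace (Xᵀ * Y * T) := trace_mul_cycle _ _ _
  have e4 : trace (X * T * Yᵀ) = trace (Xᵀ * Y * T) := by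
    rw [← e3, ← trace_transpose (X * T * Yᵀ)]
    simp [transpose_mul, hT, Matrix.mul_assoc]
  rw [transpose_sub, Matrix.sub_mul, Matrix.sub_mul, Matrix.mul_sub, Matrix.mul_sub, trace_sub,
    trace_sub, trace_sub, e1, e2, e3, e4]
  ring

theorem trace_transpose_mul_mul_le {X Y : Matrix m l ℝ} (hX : X ∈ stiefel m l)
    (hY : Y ∈ stiefel m l) {T : Matrix l l ℝ} (hT : T.PosSemidef) :
    trace (Xᵀ * Y * T) ≤ trace T := by
  have hTt : Tᵀ = T := by simpa using hT.1.eq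
  have h := (hT.mul_mul_conjTranspose_same (X - Y)).trace_nonneg
  rw [conjTranspose_eq_transpose_of_trivial, trace_sub_mul_mul_transpose_sub hX hY hTt] at h
  linarith

theorem trace_transpose_mul_le {Q : Matrix l l ℝ} (hQ : Q ∈ stiefel l l) {S : Matrix l l ℝ}
    (hS : S.PosSemidef) : trace (Qᵀ * S) ≤ trace S := by
  simpa using trace_transpose_mul_mul_le hQ (Y := 1) (by simp [stiefel]) hS

-- With `S = RᵀR`, equality of the traces says that the squared Frobenius norm of `(Q - 1)Rᵀ` is
-- zero.
open scoped MatrixOrder in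
theorem mul_eq_self_of_trace_eq {Q : Matrix l l ℝ} (hQ : Q ∈ stiefel l l) {S : Matrix l l ℝ}
    (hS : S.PosSemidef) (h : trace (Qᵀ * S) = trace S) : Q * S = S := by
  have hSt : Sᵀ = S := by simpa using hS.1.eq
  obtain ⟨R, hR⟩ : ∃ R : Matrix l l ℝ, S = Rᵀ * R := by
    obtain ⟨R, hR⟩ := CStarAlgebra.nonneg_iff_eq_star_mul_self.mp hS.nonneg
    exact ⟨R, by simpa [star_eq_conjTranspose] using hR⟩
  have h0 : trace ((Q - 1) * S * (Q - 1)ᵀ) = 0 := by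
    rw [trace_sub_mul_mul_transpose_sub hQ (by simp [stiefel]) hSt, Matrix.mul_one, h]
    ring
  have h1 : ((Q - 1) * Rᵀ) = 0 := by
    rw [← trace_mul_conjTranspose_self_eq_zero_iff, ← h0, hR]
    simp [Matrix.mul_assoc]
  have h2 : (Q - 1) * S = 0 := by rw [hR, ← Matrix.mul_assoc, h1, Matrix.zero_mul]
  rwa [Matrix.sub_mul, Matrix.one_mul, sub_eq_zero] at h2

/-- If `S` and `QᵀS` are both positive semidefinite and `Q` is orthogonal, then `QS = S`. -/
theorem mul_eq_self_of_posSemidef {Q : Matrix l l ℝ} (hQ : Q ∈ stiefel l l) {S : Matrix l l ℝ}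
    (hS : S.PosSemidef) (hT : (Qᵀ * S).PosSemidef) : Q * S = S := by
  -- The trace inequality is used twice, for `S` with `Q` and for `QᵀS` with `Qᵀ`; together they
  -- force equality.
  refine mul_eq_self_of_trace_eq hQ hS (le_antisymm (trace_transpose_mul_le hQ hS) ?_)
  have h := trace_transpose_mul_le (transpose_mem_stiefel hQ) hT
  rwa [transpose_transpose, ← Matrix.mul_assoc, mul_transpose_eq_one_of_mem_stiefel hQ,
    Matrix.one_mul] at h

end Stiefel

/-! ### Ky Fan's maximum principle and the spaces spanned by maximizers. -/

section Spectral

variable {n k : ℕ}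

theorem eig_antitone {M : Matrix (Fin n) (Fin n) ℝ} (hM : M.IsHermitian) : Antitone (eig M) := by
  intro i j hij
  simp only [eig, dif_pos hM]
  exact hM.eigenvalues₀_antitone (by simpa using hij)

/-- The eigenvector columns are permuted by `e` so that their eigenvalues appear in the decreasing
order of `eig`. -/
theorem exists_spectral {M : Matrix (Fin n) (Fin n) ℝ} (hM : M.IsHermitian) :
    ∃ U ∈ stiefel (Fin n) (Fin n), M = U * diagonal (eig M) * Uᵀ := by
  let e : Fin n ≃ Fin n := (finCongr (Fintype.card_fin n).symm).trans
    (Fintype.equivOfCardEq (Fintype.card_fin _))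
  have he : ∀ j, hM.eigenvalues (e j) = eig M j := by
    intro j
    simp only [eig, dif_pos hM]
    simp [IsHermitian.eigenvalues, e, Fin.cast]
  let U₀ : Matrix (Fin n) (Fin n) ℝ := hM.eigenvectorUnitary
  have hU₀ : U₀ᵀ * U₀ = 1 := by
    have := Unitary.coe_star_mul_self hM.eigenvectorUnitary
    simpa [star_eq_conjTranspose] using this
  have hM₀ : M = U₀ * diagonal hM.eigenvalues * U₀ᵀ := by
    have := hM.spectral_theorem
    rw [Unitary.conjStarAlgAut_apply] at this
    simpa [star_eq_conjTranspose, Function.comp_def] using this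
  refine ⟨U₀.submatrix id e, ?_, ?_⟩
  · change (U₀.submatrix id e)ᵀ * U₀.submatrix id e = 1
    rw [transpose_submatrix, ← submatrix_mul _ _ e id e Function.bijective_id, hU₀,
      submatrix_one_equiv]
  · have hd : diagonal (eig M) = (diagonal hM.eigenvalues).submatrix e e := by
      rw [submatrix_diagonal_equiv]
      exact congrArg diagonal (funext fun j => (he j).symm)
    rw [transpose_submatrix, hd, ← submatrix_mul _ _ id e e e.bijective,
      ← submatrix_mul _ _ id e id e.bijective, ← hM₀, submatrix_id_id]

/-- A symmetric idempotent matrix whose `j`-th diagonal entry is `0` or `1` has no other nonzero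
entry in its `j`-th column. -/
theorem apply_eq_zero_of_diag_mem {P : Matrix (Fin n) (Fin n) ℝ} (hPt : Pᵀ = P) (hP : P * P = P)
    {i j : Fin n} (hij : i ≠ j) (h : P j j = 0 ∨ P j j = 1) : P i j = 0 := by
  have h1 : ∑ l, P l j ^ 2 = P j j := by
    conv_rhs => rw [← hP, mul_apply]
    refine Finset.sum_congr rfl fun l _ => ?_
    rw [sq]
    conv_lhs => rw [← hPt, transpose_apply]
    conv_rhs => rw [← hPt, transpose_apply, transpose_apply]
    rw [← transpose_apply P j l, hPt]
  have h2 : P i j ^ 2 + P j j ^ 2 ≤ P j j := by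
    conv_rhs => rw [← h1]
    rw [← Finset.sum_pair (f := fun l => P l j ^ 2) hij]
    exact Finset.sum_le_sum_of_subset_of_nonneg (Finset.subset_univ _) fun _ _ _ => sq_nonneg _
  have h3 : P i j ^ 2 ≤ 0 := by rcases h with h | h <;> rw [h] at h2 <;> linarith
  exact pow_eq_zero_iff two_ne_zero |>.mp (le_antisymm h3 (sq_nonneg _))

theorem diag_mem_Icc {P : Matrix (Fin n) (Fin n) ℝ} (hPt : Pᵀ = P) (hP : P * P = P) (j : Fin n) :
    0 ≤ P j j ∧ P j j ≤ 1 := by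
  have h1 : ∑ l, P j l * P l j = P j j := by
    conv_rhs => rw [← hP, mul_apply]
  have h2 : P j j ^ 2 ≤ P j j := by
    conv_rhs => rw [← h1]
    rw [sq]
    refine Finset.single_le_sum (f := fun l => P j l * P l j) (fun l _ => ?_) (Finset.mem_univ j)
    rw [← transpose_apply P l j, hPt]
    exact mul_self_nonneg _
  constructor <;> nlinarith

theorem sum_castLE (hk : k ≤ n) (c : Fin n → ℝ) :
    ∑ j : Fin k, c (Fin.castLE hk j) = ∑ j : Fin n, if (j : ℕ) < k then c j else 0 := by
  rw [← Finset.sum_filter]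
  refine Finset.sum_bij (fun j _ => Fin.castLE hk j) ?_ ?_ ?_ ?_
  · intro j _; simp
  · intro i _ j _ h; simpa using h
  · intro j hj
    exact ⟨⟨j, (Finset.mem_filter.mp hj).2⟩, Finset.mem_univ _, rfl⟩
  · intro j _; rfl

/-- The gap between the sum of the first `k` entries of `c` and the weighted sum of `c` with weights
of total mass `k`. -/
theorem sum_castLE_sub_sum_mul (hk : k ≤ n) (c p : Fin n → ℝ) (hp : ∑ j, p j = k) (μ : ℝ) :
    ∑ j : Fin k, c (Fin.castLE hk j) - ∑ j, c j * p j =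
      ∑ j : Fin n, if (j : ℕ) < k then (c j - μ) * (1 - p j) else (μ - c j) * p j := by
  have h1 : ∑ j : Fin n, (if (j : ℕ) < k then (1 : ℝ) else 0) = k := by
    rw [← sum_castLE hk fun _ => (1 : ℝ)]; simp
  -- Both families of weights have total mass `k`, so shifting `c` by any constant `μ` leaves the
  -- gap unchanged.
  have h2 : ∑ j : Fin n, μ * ((if (j : ℕ) < k then (1 : ℝ) else 0) - p j) = 0 := by
    rw [← Finset.mul_sum, Finset.sum_sub_distrib, h1, hp]; ring
  rw [sum_castLE, ← sub_eq_zero, ← Finset.sum_sub_distrib, ← Finset.sum_sub_distrib]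
  refine Eq.trans ?_ h2
  refine Finset.sum_congr rfl fun j _ => ?_
  split_ifs <;> ring

/-- The data of a trace `tr(YᵀMY)` in an eigenbasis of `M`. -/
theorem exists_weights (hk : 1 ≤ k) (hkn : k ≤ n) {M : Matrix (Fin n) (Fin n) ℝ} {U}
    (hU : U ∈ stiefel (Fin n) (Fin n)) (hMU : M = U * diagonal (eig M) * Uᵀ)
    {Y : Matrix (Fin n) (Fin k) ℝ} (hY : Y ∈ stiefel (Fin n) (Fin k)) :
    (Uᵀ * (Y * Yᵀ) * U)ᵀ = Uᵀ * (Y * Yᵀ) * U ∧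
    (Uᵀ * (Y * Yᵀ) * U) * (Uᵀ * (Y * Yᵀ) * U) = Uᵀ * (Y * Yᵀ) * U ∧
    Y * Yᵀ = U * (Uᵀ * (Y * Yᵀ) * U) * Uᵀ ∧
    topTraceDefect hkn M Y = ∑ j : Fin n, if (j : ℕ) < k then
      (eig M j - eig M ⟨k - 1, by omega⟩) * (1 - (Uᵀ * (Y * Yᵀ) * U) j j) else
      (eig M ⟨k - 1, by omega⟩ - eig M j) * (Uᵀ * (Y * Yᵀ) * U) j j := by
  have hUU : Uᵀ * U = 1 := hU
  have hUU' : U * Uᵀ = 1 := mul_transpose_eq_one_of_mem_stiefel hU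
  have hYY : Yᵀ * Y = 1 := hY
  refine ⟨by simp [transpose_mul, Matrix.mul_assoc], ?_, ?_, ?_⟩
  · calc (Uᵀ * (Y * Yᵀ) * U) * (Uᵀ * (Y * Yᵀ) * U)
        = Uᵀ * Y * Yᵀ * (U * Uᵀ) * Y * Yᵀ * U := by simp only [Matrix.mul_assoc]
      _ = Uᵀ * Y * (Yᵀ * Y) * Yᵀ * U := by simp only [hUU', Matrix.mul_one, Matrix.mul_assoc]
      _ = _ := by simp only [hYY, Matrix.mul_one, Matrix.mul_assoc]
  · calc Y * Yᵀ = (U * Uᵀ) * (Y * Yᵀ) * (U * Uᵀ) := by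
          rw [hUU', Matrix.one_mul, Matrix.mul_one]
      _ = _ := by simp only [Matrix.mul_assoc]
  · rw [← sum_castLE_sub_sum_mul hkn (eig M) (fun j => (Uᵀ * (Y * Yᵀ) * U) j j), topTraceDefect]
    · congr 1
      calc trace (Yᵀ * M * Y) = trace (Yᵀ * (U * diagonal (eig M) * Uᵀ) * Y) := by rw [← hMU]
        _ = trace (diagonal (eig M) * (Uᵀ * (Y * Yᵀ) * U)) := by
          rw [show Yᵀ * (U * diagonal (eig M) * Uᵀ) * Y =
              (Yᵀ * U) * (diagonal (eig M) * (Uᵀ * Y)) by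
            simp only [Matrix.mul_assoc], trace_mul_comm]
          simp only [Matrix.mul_assoc]
        _ = _ := by simp [trace, diagonal_mul]
    · change trace (Uᵀ * (Y * Yᵀ) * U) = k
      rw [trace_mul_cycle, hUU', Matrix.one_mul, trace_mul_comm, hYY]
      simp

/-- Taking `μ` to be the `k`-th largest eigenvalue makes every summand of the weighted formula
nonnegative, because a projection has diagonal entries in `[0, 1]`. -/
theorem topTraceDefect_nonneg (hk : 1 ≤ k) (hkn : k ≤ n) {M : Matrix (Fin n) (Fin n) ℝ}
    (hM : M.IsHermitian) {Y : Matrix (Fin n) (Fin k) ℝ} (hY : Y ∈ stiefel (Fin n) (Fin k)) :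
    0 ≤ topTraceDefect hkn M Y := by
  obtain ⟨U, hU, hMU⟩ := exists_spectral hM
  obtain ⟨h1, h2, -, h4⟩ := exists_weights hk hkn hU hMU hY
  rw [h4]
  refine Finset.sum_nonneg fun j _ => ?_
  obtain ⟨h5, h6⟩ := diag_mem_Icc h1 h2 j
  split_ifs with hj
  · refine mul_nonneg (sub_nonneg.mpr (eig_antitone hM ?_)) (by linarith)
    rw [Fin.le_def]; simp only; omega
  · refine mul_nonneg (sub_nonneg.mpr (eig_antitone hM ?_)) h5
    rw [Fin.le_def]; simp only; omega

theorem weights_of_topTraceDefect_eq_zero (hk : 1 ≤ k) (hkn : k ≤ n)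
    {M : Matrix (Fin n) (Fin n) ℝ} (hM : M.IsHermitian) {U}
    (hU : U ∈ stiefel (Fin n) (Fin n)) (hMU : M = U * diagonal (eig M) * Uᵀ)
    {Y : Matrix (Fin n) (Fin k) ℝ} (hY : Y ∈ stiefel (Fin n) (Fin k))
    (h : topTraceDefect hkn M Y = 0) (j : Fin n) :
    eig M j = eig M ⟨k - 1, by omega⟩ ∨
      (Uᵀ * (Y * Yᵀ) * U) j j = if (j : ℕ) < k then 1 else 0 := by
  obtain ⟨h1, h2, -, h4⟩ := exists_weights hk hkn hU hMU hY
  rw [h, eq_comm, Finset.sum_eq_zero_iff_of_nonneg] at h4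
  · have h5 := h4 j (Finset.mem_univ j)
    split_ifs at h5 ⊢ with hj
    · rcases mul_eq_zero.mp h5 with h6 | h6
      · exact Or.inl (sub_eq_zero.mp h6)
      · exact Or.inr (sub_eq_zero.mp h6).symm
    · rcases mul_eq_zero.mp h5 with h6 | h6
      · exact Or.inl (sub_eq_zero.mp h6).symm
      · exact Or.inr h6
  · intro j _
    obtain ⟨h5, h6⟩ := diag_mem_Icc h1 h2 j
    split_ifs with hj
    · refine mul_nonneg (sub_nonneg.mpr (eig_antitone hM ?_)) (by linarith)
      rw [Fin.le_def]; simp only; omega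
    · refine mul_nonneg (sub_nonneg.mpr (eig_antitone hM ?_)) h5
      rw [Fin.le_def]; simp only; omega

/-- A maximizer of the trace spans an invariant subspace. -/
theorem comm_of_topTraceDefect_eq_zero (hk : 1 ≤ k) (hkn : k ≤ n) {M : Matrix (Fin n) (Fin n) ℝ}
    (hM : M.IsHermitian) {Y : Matrix (Fin n) (Fin k) ℝ} (hY : Y ∈ stiefel (Fin n) (Fin k))
    (h : topTraceDefect hkn M Y = 0) : M * (Y * Yᵀ) = Y * Yᵀ * M := by
  obtain ⟨U, hU, hMU⟩ := exists_spectral hM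
  obtain ⟨h1, h2, h3, -⟩ := exists_weights hk hkn hU hMU hY
  have hw := weights_of_topTraceDefect_eq_zero hk hkn hM hU hMU hY h
  set P := Uᵀ * (Y * Yᵀ) * U with hPdef
  have hUU : Uᵀ * U = 1 := hU
  have hw' : ∀ j, eig M j = eig M ⟨k - 1, by omega⟩ ∨ (P j j = 0 ∨ P j j = 1) := by
    intro j
    refine (hw j).imp_right fun h => ?_
    rw [h]; split_ifs <;> simp
  -- An off-diagonal entry of `P` can survive only if both indices belong to the `k`-th eigenvalue,
  -- and there the diagonal matrix is scalar.
  have hcomm : diagonal (eig M) * P = P * diagonal (eig M) := by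
    ext i j
    rw [diagonal_mul, mul_diagonal]
    by_cases hij : i = j
    · subst hij; ring
    · rcases hw' j with hj | hj
      · rcases hw' i with hi | hi
        · rw [hi, hj]; ring
        · have : P i j = 0 := by
            rw [← h1, transpose_apply]
            exact apply_eq_zero_of_diag_mem h1 h2 (Ne.symm hij) hi
          rw [this]; ring
      · rw [apply_eq_zero_of_diag_mem h1 h2 hij hj]; ring
  rw [h3]
  calc M * (U * P * Uᵀ) = U * diagonal (eig M) * Uᵀ * (U * P * Uᵀ) := by rw [← hMU]
    _ = U * diagonal (eig M) * (Uᵀ * U) * P * Uᵀ := by simp only [Matrix.mul_assoc]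
    _ = U * (diagonal (eig M) * P) * Uᵀ := by
      simp only [hUU, Matrix.mul_one, Matrix.mul_assoc]
    _ = U * P * (Uᵀ * U) * diagonal (eig M) * Uᵀ := by
      simp only [hcomm, hUU, Matrix.mul_one, Matrix.mul_assoc]
    _ = U * P * Uᵀ * (U * diagonal (eig M) * Uᵀ) := by simp only [Matrix.mul_assoc]
    _ = U * P * Uᵀ * M := by rw [← hMU]

/-- Under an eigenvalue gap the maximizers of the trace all span the same subspace. -/
theorem proj_eq_of_topTraceDefect_eq_zero (hk : 1 ≤ k) (hkn : k < n)
    {M : Matrix (Fin n) (Fin n) ℝ} (hM : M.IsHermitian)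
    (hgap : eig M ⟨k, hkn⟩ < eig M ⟨k - 1, by omega⟩)
    {Y Z : Matrix (Fin n) (Fin k) ℝ} (hY : Y ∈ stiefel (Fin n) (Fin k))
    (hZ : Z ∈ stiefel (Fin n) (Fin k)) (hY0 : topTraceDefect hkn.le M Y = 0)
    (hZ0 : topTraceDefect hkn.le M Z = 0) : Y * Yᵀ = Z * Zᵀ := by
  obtain ⟨U, hU, hMU⟩ := exists_spectral hM
  suffices key : ∀ Y ∈ stiefel (Fin n) (Fin k), topTraceDefect hkn.le M Y = 0 →
      Uᵀ * (Y * Yᵀ) * U = diagonal fun j : Fin n => if (j : ℕ) < k then 1 else 0 by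
    rw [(exists_weights hk hkn.le hU hMU hY).2.2.1, (exists_weights hk hkn.le hU hMU hZ).2.2.1,
      key Y hY hY0, key Z hZ hZ0]
  intro Y hY h
  obtain ⟨h1, h2, h3, -⟩ := exists_weights hk hkn.le hU hMU hY
  have hw := weights_of_topTraceDefect_eq_zero hk hkn.le hM hU hMU hY h
  set P := Uᵀ * (Y * Yᵀ) * U with hPdef
  have hdiag : ∀ j : Fin n, P j j = if (j : ℕ) < k then 1 else 0 := by
    -- The gap excludes a tie with the `k`-th eigenvalue beyond index `k - 1`, so those diagonal
    -- entries vanish.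
    have hge : ∀ j : Fin n, ¬ (j : ℕ) < k → P j j = 0 := by
      intro j hj
      rcases hw j with h | h
      · have : eig M j ≤ eig M ⟨k, hkn⟩ := eig_antitone hM (by rw [Fin.le_def]; simp only; omega)
        linarith
      · rwa [if_neg hj] at h
    -- The trace of `P` is `k`, so with nothing beyond the first `k` places each entry there must
    -- reach its bound `1`.
    have hsum : ∑ j : Fin n, ((if (j : ℕ) < k then (1 : ℝ) else 0) - P j j) = 0 := by
      rw [Finset.sum_sub_distrib, ← sum_castLE hkn.le fun _ => (1 : ℝ)]
      have : ∑ j, P j j = k := by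
        change trace P = k
        rw [hPdef, trace_mul_cycle, mul_transpose_eq_one_of_mem_stiefel hU, Matrix.one_mul,
          trace_mul_comm, show Yᵀ * Y = 1 from hY]
        simp
      rw [this]; simp
    rw [Finset.sum_eq_zero_iff_of_nonneg] at hsum
    · intro j
      have := hsum j (Finset.mem_univ j)
      linarith
    · intro j _
      split_ifs with hj
      · linarith [(diag_mem_Icc h1 h2 j).2]
      · rw [hge j hj]; simp
  ext i j
  by_cases hij : i = j
  · subst hij; rw [hdiag, diagonal_apply_eq]
  · rw [diagonal_apply_ne _ hij]
    refine apply_eq_zero_of_diag_mem h1 h2 hij ?_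
    rw [hdiag]; split_ifs <;> simp

theorem exists_topTraceDefect_eq_zero (hkn : k ≤ n) {M : Matrix (Fin n) (Fin n) ℝ}
    (hM : M.IsHermitian) :
    ∃ Y ∈ stiefel (Fin n) (Fin k), topTraceDefect hkn M Y = 0 := by
  obtain ⟨U, hU, hMU⟩ := exists_spectral hM
  have hUU : Uᵀ * U = 1 := hU
  have hY : IsTopEigenbasis hkn M (U.submatrix id (Fin.castLE hkn)) := by
    constructor
    · change (U.submatrix id (Fin.castLE hkn))ᵀ * U.submatrix id (Fin.castLE hkn) = 1
      rw [transpose_submatrix, ← submatrix_mul _ _ _ id _ Function.bijective_id, hUU,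
        submatrix_one _ (Fin.castLE_injective hkn)]
    · have h : M * U = U * diagonal (eig M) := by
        calc M * U = U * diagonal (eig M) * Uᵀ * U := by rw [← hMU]
          _ = _ := by rw [Matrix.mul_assoc, hUU, Matrix.mul_one]
      ext i j
      have := congrFun (congrFun h i) (Fin.castLE hkn j)
      rw [mul_diagonal] at this ⊢
      exact this
  exact ⟨_, hY.1, hY.topTraceDefect_eq_zero⟩

end Spectral

/-! ### The `sin Θ` distance as the norm of a projection residual. -/

section Distance

variable {n k : ℕ}

theorem sq_singularValues_eq_eig (N : Matrix (Fin n) (Fin k) ℝ) (i : Fin k) :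
    (Matrix.toEuclideanLin N).singularValues i ^ 2 = eig (Nᵀ * N) i := by
  have hN : (Nᵀ * N).IsHermitian := by
    simpa using isHermitian_conjTranspose_mul_self N
  have hT : LinearMap.adjoint (Matrix.toEuclideanLin N) ∘ₗ Matrix.toEuclideanLin N =
      Matrix.toEuclideanLin (Nᵀ * N) := by
    rw [← Matrix.toEuclideanLin_conjTranspose_eq_adjoint,
      conjTranspose_eq_transpose_of_trivial]
    ext x
    simp [Matrix.toLpLin_apply]
  -- Stated for arbitrary `T`, so that the equality of operators can be substituted although the
  -- symmetry proof depends on `T`.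
  have key : ∀ (T : EuclideanSpace ℝ (Fin k) →ₗ[ℝ] EuclideanSpace ℝ (Fin k))
      (h₁ : T.IsSymmetric), T = Matrix.toEuclideanLin (Nᵀ * N) →
      ∀ j, h₁.eigenvalues finrank_euclideanSpace j = hN.eigenvalues₀ j := by
    rintro _ h₁ rfl j
    rfl
  simp only [eig, dif_pos hN]
  rw [← key _ (LinearMap.isSymmetric_adjoint_comp_self _) hT,
    ← LinearMap.sq_singularValues_fin]
  rfl

theorem norm_transpose_mul_mul_of_mem_stiefel {U : Matrix (Fin k) (Fin k) ℝ}
    (hU : U ∈ stiefel (Fin k) (Fin k)) (M : Matrix (Fin k) (Fin k) ℝ) : ‖Uᵀ * M * U‖ = ‖M‖ := by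
  have h1 : U ∈ unitary (Matrix (Fin k) (Fin k) ℝ) := by
    rw [Unitary.mem_iff, star_eq_conjTranspose, conjTranspose_eq_transpose_of_trivial]
    exact ⟨hU, mul_transpose_eq_one_of_mem_stiefel hU⟩
  have h2 : Uᵀ ∈ unitary (Matrix (Fin k) (Fin k) ℝ) := by
    simpa [star_eq_conjTranspose] using Unitary.star_mem h1
  rw [CStarRing.norm_mul_mem_unitary _ h1, CStarRing.norm_mem_unitary_mul _ h2]

/-- The residual `Z` satisfies `ZᵀZ = 1 - NᵀN`, whose eigenvalues are `1 - σᵢ² = sin² θᵢ`; the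
C*-identity compares the norms. Continuity and independence of the basis are read off from this
form. -/
theorem sinThetaDist_eq_norm {X Y : Matrix (Fin n) (Fin k) ℝ} (hX : X ∈ stiefel (Fin n) (Fin k))
    (hY : Y ∈ stiefel (Fin n) (Fin k)) : sinThetaDist X Y = ‖Y - X * (Xᵀ * Y)‖ := by
  have hXX : Xᵀ * X = 1 := hX
  have hYY : Yᵀ * Y = 1 := hY
  set N := Xᵀ * Y with hN
  set Z := Y - X * N with hZ
  have hNH : (Nᵀ * N).IsHermitian := by simpa using isHermitian_conjTranspose_mul_self N
  obtain ⟨U, hU, hNU⟩ := exists_spectral hNH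
  have hUU : Uᵀ * U = 1 := hU
  have hNt : Yᵀ * X = Nᵀ := by rw [hN, transpose_mul, transpose_transpose]
  have hZZ : Zᵀ * Z = 1 - Nᵀ * N := by
    rw [hZ, transpose_sub, Matrix.sub_mul, Matrix.mul_sub, Matrix.mul_sub, hYY, transpose_mul,
      Matrix.mul_assoc Nᵀ Xᵀ Y, ← hN, ← Matrix.mul_assoc Yᵀ X N, hNt,
      show Nᵀ * Xᵀ * (X * N) = Nᵀ * (Xᵀ * X) * N by simp only [Matrix.mul_assoc], hXX,
      Matrix.mul_one]
    abel
  have hdiag : Uᵀ * (Zᵀ * Z) * U = diagonal fun i => 1 - eig (Nᵀ * N) i := by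
    have : Uᵀ * (Nᵀ * N) * U = diagonal (eig (Nᵀ * N)) := by
      calc Uᵀ * (Nᵀ * N) * U = Uᵀ * (U * diagonal (eig (Nᵀ * N)) * Uᵀ) * U := by rw [← hNU]
        _ = (Uᵀ * U) * diagonal (eig (Nᵀ * N)) * (Uᵀ * U) := by simp only [Matrix.mul_assoc]
        _ = _ := by rw [hUU, Matrix.one_mul, Matrix.mul_one]
    rw [hZZ, Matrix.mul_sub, Matrix.sub_mul, this, Matrix.mul_one, hUU, ← diagonal_one,
      diagonal_sub]
  have hnn : ∀ i, 0 ≤ 1 - eig (Nᵀ * N) i := by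
    intro i
    have h1 : (Uᵀ * (Zᵀ * Z) * U).PosSemidef := by
      simpa [Matrix.mul_assoc] using posSemidef_conjTranspose_mul_self (Z * U)
    rw [hdiag] at h1
    simpa using h1.diag_nonneg (i := i)
  have hsq : sinThetaDist X Y * sinThetaDist X Y = ‖Z‖ * ‖Z‖ := by
    rw [← l2_opNorm_conjTranspose_mul_self Z, conjTranspose_eq_transpose_of_trivial,
      ← norm_transpose_mul_mul_of_mem_stiefel hU, hdiag, sinThetaDist,
      ← l2_opNorm_conjTranspose_mul_self, diagonal_conjTranspose, diagonal_mul_diagonal]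
    congr 2
    funext i
    have h2 := sq_singularValues_eq_eig N i
    simp only [canonicalAngle, Real.sin_arccos, Pi.star_apply, star_trivial, ← hN, h2]
    exact Real.mul_self_sqrt (hnn i)
  exact (mul_self_inj (norm_nonneg _) (norm_nonneg _)).mp hsq

theorem sinThetaDist_nonneg (X Y : Matrix (Fin n) (Fin k) ℝ) : 0 ≤ sinThetaDist X Y :=
  norm_nonneg _

theorem sinThetaDist_mul_right {X Y : Matrix (Fin n) (Fin k) ℝ}
    (hX : X ∈ stiefel (Fin n) (Fin k)) (hY : Y ∈ stiefel (Fin n) (Fin k))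
    {Q : Matrix (Fin k) (Fin k) ℝ} (hQ : Q ∈ stiefel (Fin k) (Fin k)) :
    sinThetaDist (X * Q) Y = sinThetaDist X Y := by
  rw [sinThetaDist_eq_norm (mul_mem_stiefel hX hQ) hY, sinThetaDist_eq_norm hX hY,
    show X * Q * ((X * Q)ᵀ * Y) = X * (Q * Qᵀ) * (Xᵀ * Y) by
      simp only [transpose_mul, Matrix.mul_assoc],
    mul_transpose_eq_one_of_mem_stiefel hQ, Matrix.mul_one]

theorem sinThetaDist_eq_zero_of_proj_eq {X Y : Matrix (Fin n) (Fin k) ℝ}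
    (hX : X ∈ stiefel (Fin n) (Fin k)) (hY : Y ∈ stiefel (Fin n) (Fin k))
    (h : X * Xᵀ = Y * Yᵀ) : sinThetaDist X Y = 0 := by
  rw [sinThetaDist_eq_norm hX hY, ← Matrix.mul_assoc, h, Matrix.mul_assoc,
    show Yᵀ * Y = 1 from hY, Matrix.mul_one, sub_self, norm_zero]

/-- A zero residual means `Y = X(XᵀY)`, and orthonormality of `Y` then makes `XᵀY` orthogonal. -/
theorem exists_eq_mul_of_sinThetaDist_eq_zero {X Y : Matrix (Fin n) (Fin k) ℝ}
    (hX : X ∈ stiefel (Fin n) (Fin k)) (hY : Y ∈ stiefel (Fin n) (Fin k))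
    (h : sinThetaDist X Y = 0) : ∃ Q ∈ stiefel (Fin k) (Fin k), X = Y * Q := by
  rw [sinThetaDist_eq_norm hX hY, norm_eq_zero, sub_eq_zero] at h
  have hR : Xᵀ * Y ∈ stiefel (Fin k) (Fin k) := by
    change (Xᵀ * Y)ᵀ * (Xᵀ * Y) = 1
    rw [transpose_mul, transpose_transpose, Matrix.mul_assoc, ← h]
    exact hY
  refine ⟨(Xᵀ * Y)ᵀ, transpose_mem_stiefel hR, ?_⟩
  calc X = X * (Xᵀ * Y) * (Xᵀ * Y)ᵀ := by
        rw [Matrix.mul_assoc, mul_transpose_eq_one_of_mem_stiefel hR, Matrix.mul_one]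
    _ = Y * (Xᵀ * Y)ᵀ := by rw [← h]

theorem continuousOn_sinThetaDist {Y : Matrix (Fin n) (Fin k) ℝ}
    (hY : Y ∈ stiefel (Fin n) (Fin k)) :
    ContinuousOn (fun X => sinThetaDist X Y) (stiefel (Fin n) (Fin k)) := by
  refine ContinuousOn.congr (f := fun X : Matrix (Fin n) (Fin k) ℝ => ‖Y - X * (Xᵀ * Y)‖) ?_
    fun X hX => sinThetaDist_eq_norm hX hY
  exact (Continuous.norm (by fun_prop)).continuousOn

theorem mem_orthonormalBases_iff {X Y : Matrix (Fin n) (Fin k) ℝ}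
    (hX : X ∈ stiefel (Fin n) (Fin k)) :
    Y ∈ orthonormalBases X ↔ ∃ Q ∈ stiefel (Fin k) (Fin k), Y = X * Q := by
  constructor
  · rintro ⟨hY, h⟩
    have hmem : ∀ j, ∃ v, X *ᵥ v = Y.col j := by
      intro j
      have : Y.col j ∈ colSpace Y := ⟨Pi.single j 1, by simp⟩
      rw [h] at this
      exact this
    choose V hV using hmem
    have hYV : Y = X * (Matrix.of V)ᵀ := by
      ext i j
      exact (congrFun (hV j) i).symm
    refine ⟨_, ?_, hYV⟩
    have hYY : Yᵀ * Y = 1 := hY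
    rw [hYV, transpose_mul, Matrix.mul_assoc, ← Matrix.mul_assoc Xᵀ, show Xᵀ * X = 1 from hX,
      Matrix.one_mul] at hYY
    exact hYY
  · rintro ⟨Q, hQ, rfl⟩
    refine ⟨mul_mem_stiefel hX hQ, le_antisymm ?_ ?_⟩
    · rintro _ ⟨v, rfl⟩
      exact ⟨Q *ᵥ v, by simp⟩
    · rintro _ ⟨v, rfl⟩
      exact ⟨Qᵀ *ᵥ v, by simp [mul_transpose_eq_one_of_mem_stiefel hQ]⟩

theorem sinThetaDist_eq_zero_of_colSpace_eq {X Y : Matrix (Fin n) (Fin k) ℝ}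
    (hX : X ∈ stiefel (Fin n) (Fin k)) (hY : Y ∈ stiefel (Fin n) (Fin k))
    (h : colSpace X = colSpace Y) : sinThetaDist X Y = 0 := by
  obtain ⟨Q, hQ, rfl⟩ := (mem_orthonormalBases_iff hY).mp ⟨hX, h⟩
  refine sinThetaDist_eq_zero_of_proj_eq hX hY ?_
  rw [transpose_mul, Matrix.mul_assoc, ← Matrix.mul_assoc Q,
    mul_transpose_eq_one_of_mem_stiefel hQ, Matrix.one_mul]

end Distance

/-! ### Growth of the objective in one step, and continuity. -/

section Ascent

variable {n k : ℕ} {A B : Matrix (Fin n) (Fin n) ℝ} {D : Matrix (Fin n) (Fin k) ℝ} {θ : ℝ}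

/-- A zero trace would give `BX = 0`, putting `k` independent columns in the kernel of `B`, whose
dimension is less than `k`. -/
theorem trace_transpose_mul_mul_pos (hB : B.PosSemidef) (hBrank : n < B.rank + k)
    {X : Matrix (Fin n) (Fin k) ℝ} (hX : X ∈ stiefel (Fin n) (Fin k)) :
    0 < trace (Xᵀ * B * X) := by
  have hP : (Xᵀ * B * X).PosSemidef := by simpa using hB.conjTranspose_mul_mul_same X
  refine lt_of_le_of_ne hP.trace_nonneg fun h => ?_
  have h0 : Xᵀ * B * X = 0 := hP.trace_eq_zero_iff.mp h.symm
  have h1 : B * X = 0 := by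
    ext i j
    have h2 : B *ᵥ X.col j = 0 := by
      rw [← hB.dotProduct_mulVec_zero_iff]
      have h3 := congrFun (congrFun h0 j) j
      rw [Matrix.mul_assoc] at h3
      exact h3
    exact congrFun h2 i
  have h4 := rank_add_rank_le_card_of_mul_eq_zero h1
  have h5 : X.rank = k := by
    rw [← rank_transpose_mul_self, show Xᵀ * X = 1 from hX, rank_one, Fintype.card_fin]
  rw [h5, Fintype.card_fin] at h4
  omega

theorem f_one (X : Matrix (Fin n) (Fin k) ℝ) :
    f A B D 1 X = trace (Xᵀ * A * X + Xᵀ * D) / trace (Xᵀ * B * X) := by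
  rw [f, Real.rpow_one]

/-- The trace of `E(X)` compressed to the column space of `Y`. -/
theorem trace_transpose_mul_E_mul (X Y : Matrix (Fin n) (Fin k) ℝ) :
    trace (Yᵀ * E A B D θ X * Y) = 2 / trace (Xᵀ * B * X) ^ θ *
      (trace (Yᵀ * A * Y) + trace (Yᵀ * D * Xᵀ * Y) - θ * f A B D 1 X * trace (Yᵀ * B * Y)) := by
  have h : trace (Yᵀ * X * Dᵀ * Y) = trace (Yᵀ * D * Xᵀ * Y) := by
    rw [← trace_transpose]
    simp only [transpose_mul, transpose_transpose, Matrix.mul_assoc]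
  have e : Yᵀ * E A B D θ X * Y = (2 / trace (Xᵀ * B * X) ^ θ) •
      (Yᵀ * A * Y + (1 / 2 : ℝ) • (Yᵀ * D * Xᵀ * Y + Yᵀ * X * Dᵀ * Y) -
        (θ * f A B D 1 X) • (Yᵀ * B * Y)) := by
    simp only [E, Matrix.mul_smul, Matrix.smul_mul, Matrix.mul_sub, Matrix.sub_mul, Matrix.mul_add,
      Matrix.add_mul, Matrix.mul_assoc]
  rw [e]
  simp only [trace_smul, trace_sub, trace_add, h, smul_eq_mul]
  ring

theorem trace_mul_right_orthogonal (M : Matrix (Fin n) (Fin n) ℝ) (Y : Matrix (Fin n) (Fin k) ℝ)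
    {Q : Matrix (Fin k) (Fin k) ℝ} (hQ : Q ∈ stiefel (Fin k) (Fin k)) :
    trace ((Y * Q)ᵀ * M * (Y * Q)) = trace (Yᵀ * M * Y) := by
  rw [show (Y * Q)ᵀ * M * (Y * Q) = Qᵀ * (Yᵀ * M * Y) * Q by
    simp only [transpose_mul, Matrix.mul_assoc], trace_mul_cycle,
    mul_transpose_eq_one_of_mem_stiefel hQ, Matrix.one_mul]

theorem trace_self_E (X : Matrix (Fin n) (Fin k) ℝ) (hX : X ∈ stiefel (Fin n) (Fin k))
    (hb : 0 < trace (Xᵀ * B * X)) :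
    trace (Xᵀ * E A B D θ X * X) = 2 / trace (Xᵀ * B * X) ^ θ *
      ((1 - θ) * trace (Xᵀ * A * X + Xᵀ * D)) := by
  rw [trace_transpose_mul_E_mul, f_one, Matrix.mul_assoc (Xᵀ * D), show Xᵀ * X = 1 from hX,
    Matrix.mul_one, trace_add]
  field_simp

/-- Alignment matters here: `YᵀD ⪰ 0` bounds the mixed term `tr(YᵀDXᵀY)` by `tr(YᵀD)`, the linear
term of the objective at `Y`. -/
theorem trace_E_le {X Y : Matrix (Fin n) (Fin k) ℝ} (hX : X ∈ stiefel (Fin n) (Fin k))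
    (hY : Y ∈ stiefel (Fin n) (Fin k)) (hYD : (Yᵀ * D).PosSemidef)
    (hb : 0 < trace (Xᵀ * B * X)) :
    trace (Yᵀ * E A B D θ X * Y) ≤ 2 / trace (Xᵀ * B * X) ^ θ *
      (trace (Yᵀ * A * Y + Yᵀ * D) - θ * f A B D 1 X * trace (Yᵀ * B * Y)) := by
  rw [trace_transpose_mul_E_mul, trace_add]
  have h : trace (Yᵀ * D * Xᵀ * Y) ≤ trace (Yᵀ * D) := by
    rw [Matrix.mul_assoc (Yᵀ * D), trace_mul_comm]
    exact trace_transpose_mul_mul_le hX hY hYD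
  have : 0 ≤ 2 / trace (Xᵀ * B * X) ^ θ := by positivity
  gcongr

/-- One step of the iteration: with `T` the increase of the trace of the compression of `E(X)`, the
objective increases by at least `T / 2 · (b / b')^θ`. -/
theorem ascent_step (hθ₀ : 0 ≤ θ) (hθ₁ : θ ≤ 1) {X Y : Matrix (Fin n) (Fin k) ℝ}
    (hX : X ∈ stiefel (Fin n) (Fin k)) (hY : Y ∈ stiefel (Fin n) (Fin k))
    (hYD : (Yᵀ * D).PosSemidef) (hb : 0 < trace (Xᵀ * B * X)) (hb' : 0 < trace (Yᵀ * B * Y))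
    (hg : 0 < θ → θ < 1 → 0 ≤ trace (Xᵀ * A * X + Xᵀ * D)) {T : ℝ}
    (hT : trace (Yᵀ * E A B D θ X * Y) - trace (Xᵀ * E A B D θ X * X) = T) (hT0 : 0 ≤ T) :
    (0 < θ → θ < 1 → 0 ≤ trace (Yᵀ * A * Y + Yᵀ * D)) ∧
    T / 2 * (trace (Xᵀ * B * X) / trace (Yᵀ * B * Y)) ^ θ ≤ f A B D θ Y - f A B D θ X := by
  have h1 := trace_E_le (A := A) (θ := θ) hX hY hYD hb
  have h2 := trace_self_E (A := A) (D := D) (θ := θ) X hX hb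
  rw [f_one] at h1
  rw [f, f]
  set g := trace (Xᵀ * A * X + Xᵀ * D)
  set g' := trace (Yᵀ * A * Y + Yᵀ * D)
  set b := trace (Xᵀ * B * X)
  set b' := trace (Yᵀ * B * Y)
  have hbθ : 0 < b ^ θ := Real.rpow_pos_of_pos hb θ
  have hbθ' : 0 < b' ^ θ := Real.rpow_pos_of_pos hb' θ
  have h3 : T * b ^ θ / 2 + g * (1 + θ * (b' / b - 1)) ≤ g' := by
    have : T ≤ 2 / b ^ θ * (g' - θ * (g / b) * b') - 2 / b ^ θ * ((1 - θ) * g) := by linarith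
    rw [← mul_sub, div_mul_eq_mul_div, le_div_iff₀ hbθ] at this
    have e : g * (1 + θ * (b' / b - 1)) = θ * (g / b) * b' + (1 - θ) * g := by
      field_simp; ring
    rw [e]; linarith
  -- Bernoulli's inequality `(1 + s)^θ ≤ 1 + θs` with `s = b'/b - 1`. At `θ = 0` and `θ = 1` it is
  -- an equality, so the sign of `g` matters only in between.
  have h4 : g * (b' / b) ^ θ ≤ g * (1 + θ * (b' / b - 1)) := by
    rcases eq_or_lt_of_le hθ₀ with h | h
    · rw [← h]; simp
    rcases eq_or_lt_of_le hθ₁ with h' | h'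
    · rw [h', Real.rpow_one]
      apply le_of_eq; ring
    · refine mul_le_mul_of_nonneg_left ?_ (hg h h')
      have := rpow_one_add_le_one_add_mul_self (s := b' / b - 1)
        (by have : 0 < b' / b := by positivity
            linarith) hθ₀ hθ₁
      rwa [add_sub_cancel] at this
  constructor
  · intro h h'
    have := hg h h'
    have : 0 ≤ g * (b' / b) ^ θ := by positivity
    have : 0 ≤ T * b ^ θ / 2 := by positivity
    linarith
  · have h5 : T * b ^ θ / 2 + g * (b' / b) ^ θ ≤ g' := by linarith
    rw [Real.div_rpow hb'.le hb.le] at h5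
    rw [Real.div_rpow hb.le hb'.le, le_sub_iff_add_le, le_div_iff₀ hbθ']
    refine le_trans (le_of_eq ?_) h5
    field_simp

theorem continuous_trace_transpose_mul_mul (M : Matrix (Fin n) (Fin n) ℝ) :
    Continuous fun X : Matrix (Fin n) (Fin k) ℝ => trace (Xᵀ * M * X) :=
  Continuous.matrix_trace (by fun_prop)

theorem continuousOn_f (hB : B.PosSemidef) (hBrank : n < B.rank + k) (θ : ℝ) :
    ContinuousOn (f A B D θ) (stiefel (Fin n) (Fin k)) := by
  have h : Continuous fun X : Matrix (Fin n) (Fin k) ℝ => trace (Xᵀ * A * X + Xᵀ * D) :=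
    Continuous.matrix_trace (by fun_prop)
  refine ContinuousOn.div h.continuousOn ?_ fun X hX =>
    (Real.rpow_pos_of_pos (trace_transpose_mul_mul_pos hB hBrank hX) θ).ne'
  exact (continuous_trace_transpose_mul_mul B).continuousOn.rpow_const fun X hX =>
    Or.inl (trace_transpose_mul_mul_pos hB hBrank hX).ne'

theorem continuousOn_E (hB : B.PosSemidef) (hBrank : n < B.rank + k) (θ : ℝ) :
    ContinuousOn (E A B D θ) (stiefel (Fin n) (Fin k)) := by
  have h1 := continuousOn_f (A := A) (D := D) hB hBrank 1
  have h2 : Continuous fun X : Matrix (Fin n) (Fin k) ℝ =>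
      A + (1 / 2 : ℝ) • (D * Xᵀ + X * Dᵀ) := by fun_prop
  have h3 : ContinuousOn (fun X : Matrix (Fin n) (Fin k) ℝ => 2 / trace (Xᵀ * B * X) ^ θ)
      (stiefel (Fin n) (Fin k)) := by
    refine continuousOn_const.div ?_ fun X hX =>
      (Real.rpow_pos_of_pos (trace_transpose_mul_mul_pos hB hBrank hX) θ).ne'
    exact (continuous_trace_transpose_mul_mul B).continuousOn.rpow_const fun X hX =>
      Or.inl (trace_transpose_mul_mul_pos hB hBrank hX).ne'
  have h4 : ContinuousOn (fun X : Matrix (Fin n) (Fin k) ℝ => (θ * f A B D 1 X) • B)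
      (stiefel (Fin n) (Fin k)) := (continuousOn_const.mul h1).smul continuousOn_const
  exact h3.smul (h2.continuousOn.sub h4)

end Ascent

/-! ### Monotonicity along the iteration and vanishing of the trace gains. -/

section Iteration

variable {n k : ℕ} {A B : Matrix (Fin n) (Fin n) ℝ} {D : Matrix (Fin n) (Fin k) ℝ} {θ : ℝ}
  {hkn : k ≤ n} {X Xhat : ℕ → Matrix (Fin n) (Fin k) ℝ}

theorem IsSCF.hat_mem (hX : IsSCF hkn A B D θ X Xhat) (i : ℕ) :
    Xhat (i + 1) ∈ stiefel (Fin n) (Fin k) := by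
  rcases hX.step i with h | h
  exacts [h.1, h.1]

theorem IsSCF.exists_next (hX : IsSCF hkn A B D θ X Xhat) (i : ℕ) :
    ∃ Q ∈ stiefel (Fin k) (Fin k), X (i + 1) = Xhat (i + 1) * Q := by
  obtain ⟨U, σ, V, h, hX'⟩ := hX.next i
  exact ⟨U * Vᵀ, mul_mem_stiefel h.left_mem (transpose_mem_stiefel h.right_mem),
    by rw [hX', Matrix.mul_assoc]⟩

theorem IsSCF.mem (hX : IsSCF hkn A B D θ X Xhat) : ∀ i, X i ∈ stiefel (Fin n) (Fin k)
  | 0 => hX.init_mem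
  | i + 1 => by
    obtain ⟨Q, hQ, h⟩ := hX.exists_next i
    rw [h]
    exact mul_mem_stiefel (hX.hat_mem i) hQ

/-- The factor `U` cancels, leaving `VΣVᵀ`. The initial iterate is not aligned, hence the shifted
index. -/
theorem IsSCF.posSemidef (hX : IsSCF hkn A B D θ X Xhat) (i : ℕ) :
    ((X (i + 1))ᵀ * D).PosSemidef := by
  obtain ⟨U, σ, V, h, hX'⟩ := hX.next i
  have e : (X (i + 1))ᵀ * D = V * diagonal σ * Vᵀ := by
    calc (X (i + 1))ᵀ * D = V * Uᵀ * ((Xhat (i + 1))ᵀ * D) := by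
          rw [hX']; simp only [transpose_mul, transpose_transpose, Matrix.mul_assoc]
      _ = V * (Uᵀ * U) * diagonal σ * Vᵀ := by rw [h.eq]; simp only [Matrix.mul_assoc]
      _ = _ := by rw [show Uᵀ * U = 1 from h.left_mem, Matrix.mul_one]
  rw [e]
  simpa using (PosSemidef.diagonal (d := σ) h.nonneg).mul_mul_conjTranspose_same V

theorem IsSCF.trace_le (hk : 1 ≤ k) (hA : A.IsSymm) (hB : B.IsSymm)
    (hX : IsSCF hkn A B D θ X Xhat) (i : ℕ) :
    0 ≤ trace ((Xhat (i + 1))ᵀ * E A B D θ (X i) * Xhat (i + 1)) -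
      trace ((X i)ᵀ * E A B D θ (X i) * X i) := by
  rcases hX.step i with h | h
  · have h1 := h.topTraceDefect_eq_zero
    have h2 := topTraceDefect_nonneg hk hkn (E_isHermitian hA hB D θ (X i)) (hX.mem i)
    rw [topTraceDefect] at h1 h2
    linarith
  · linarith [h.2]

theorem IsSCF.ascent (hk : 1 ≤ k) (hA : A.IsSymm) (hB : B.PosSemidef) (hBrank : n < B.rank + k)
    (hθ₀ : 0 ≤ θ) (hθ₁ : θ ≤ 1) (hX : IsSCF hkn A B D θ X Xhat) (i : ℕ) :
    (0 < θ → θ < 1 → 0 ≤ trace ((X i)ᵀ * A * X i + (X i)ᵀ * D)) ∧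
    (trace ((Xhat (i + 1))ᵀ * E A B D θ (X i) * Xhat (i + 1)) -
      trace ((X i)ᵀ * E A B D θ (X i) * X i)) / 2 *
      (trace ((X i)ᵀ * B * X i) / trace ((X (i + 1))ᵀ * B * X (i + 1))) ^ θ ≤
      f A B D θ (X (i + 1)) - f A B D θ (X i) := by
  have hBs : B.IsSymm := by simpa using hB.1
  have key : ∀ i, (0 < θ → θ < 1 → 0 ≤ trace ((X i)ᵀ * A * X i + (X i)ᵀ * D)) → _ := fun i hg =>
    ascent_step (A := A) (B := B) (D := D) hθ₀ hθ₁ (hX.mem i) (hX.mem (i + 1)) (hX.posSemidef i)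
      (trace_transpose_mul_mul_pos hB hBrank (hX.mem i))
      (trace_transpose_mul_mul_pos hB hBrank (hX.mem (i + 1))) hg
      (T := trace ((Xhat (i + 1))ᵀ * E A B D θ (X i) * Xhat (i + 1)) -
        trace ((X i)ᵀ * E A B D θ (X i) * X i))
      (by
        obtain ⟨Q, hQ, h⟩ := hX.exists_next i
        rw [h, trace_mul_right_orthogonal _ _ hQ])
      (hX.trace_le hk hA hBs i)
  -- The ascent step needs the sign of the numerator and also reproduces it, so it propagates from
  -- `X 0`.
  have hg : ∀ i, 0 < θ → θ < 1 → 0 ≤ trace ((X i)ᵀ * A * X i + (X i)ᵀ * D) := by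
    intro i
    induction i with
    | zero => exact hX.init_nonneg
    | succ i ih => exact (key i ih).1
  exact ⟨hg i, (key i (hg i)).2⟩

/-- The trace increments of the iteration tend to zero. -/
theorem IsSCF.tendsto_trace_sub (hk : 1 ≤ k) (hA : A.IsSymm) (hB : B.PosSemidef)
    (hBrank : n < B.rank + k) (hθ₀ : 0 ≤ θ) (hθ₁ : θ ≤ 1) (hX : IsSCF hkn A B D θ X Xhat) :
    Tendsto (fun i => trace ((Xhat (i + 1))ᵀ * E A B D θ (X i) * Xhat (i + 1)) -
      trace ((X i)ᵀ * E A B D θ (X i) * X i)) atTop (𝓝 0) := by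
  have hBs : B.IsSymm := by simpa using hB.1
  have hpos : ∀ i, 0 < trace ((X i)ᵀ * B * X i) := fun i =>
    trace_transpose_mul_mul_pos hB hBrank (hX.mem i)
  have hT := hX.trace_le hk hA hBs
  have hasc := fun i => (hX.ascent hk hA hB hBrank hθ₀ hθ₁ i).2
  have hmono : Monotone fun i => f A B D θ (X i) := by
    refine monotone_nat_of_le_succ fun i => ?_
    have h1 := hasc i
    have h2 : 0 ≤ (trace ((X i)ᵀ * B * X i) /
        trace ((X (i + 1))ᵀ * B * X (i + 1))) ^ θ :=
      Real.rpow_nonneg (div_nonneg (hpos i).le (hpos (i + 1)).le) θ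
    have h3 := mul_nonneg (div_nonneg (hT i) zero_le_two) h2
    linarith
  have hbdd : BddAbove (Set.range fun i => f A B D θ (X i)) := by
    refine (isCompact_stiefel.bddAbove_image
      (continuousOn_f (A := A) (D := D) hB hBrank θ)).mono ?_
    rintro _ ⟨i, rfl⟩
    exact ⟨X i, hX.mem i, rfl⟩
  have hlim := tendsto_atTop_ciSup hmono hbdd
  have hdiff : Tendsto (fun i => f A B D θ (X (i + 1)) - f A B D θ (X i)) atTop (𝓝 0) := by
    simpa using ((tendsto_add_atTop_iff_nat 1).mpr hlim).sub hlim
  -- The extrema of `tr(XᵀBX)` on the compact set of orthonormal bases bound the factor `(b / b')^θ`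
  -- below by a uniform `c > 0`.
  have hne : (stiefel (Fin n) (Fin k)).Nonempty := ⟨X 0, hX.mem 0⟩
  obtain ⟨Z, hZ, hmin⟩ := isCompact_stiefel.exists_isMinOn hne
    (continuous_trace_transpose_mul_mul (k := k) B).continuousOn
  obtain ⟨Z', hZ', hmax⟩ := isCompact_stiefel.exists_isMaxOn hne
    (continuous_trace_transpose_mul_mul (k := k) B).continuousOn
  have hZ0 := trace_transpose_mul_mul_pos hB hBrank hZ
  have hZ0' := trace_transpose_mul_mul_pos hB hBrank hZ'
  set c := (trace (Zᵀ * B * Z) / trace (Z'ᵀ * B * Z')) ^ θ with hc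
  have hc0 : 0 < c := Real.rpow_pos_of_pos (div_pos hZ0 hZ0') θ
  have hlower : ∀ i, c ≤ (trace ((X i)ᵀ * B * X i) /
      trace ((X (i + 1))ᵀ * B * X (i + 1))) ^ θ := fun i =>
    Real.rpow_le_rpow (div_pos hZ0 hZ0').le
      (div_le_div₀ (hpos i).le (hmin (hX.mem i)) (hpos (i + 1)) (hmax (hX.mem (i + 1)))) hθ₀
  refine squeeze_zero hT (g := fun i => 2 / c * (f A B D θ (X (i + 1)) - f A B D θ (X i))) ?_ ?_
  · intro i
    have h1 := (mul_le_mul_of_nonneg_left (hlower i) (div_nonneg (hT i) zero_le_two)).trans (hasc i)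
    rw [div_mul_eq_mul_div, le_div_iff₀ hc0]
    linarith
  · simpa using hdiff.const_mul (2 / c)

/-- The iterates asymptotically attain the sum of the `k` largest eigenvalues. -/
theorem IsSCF.tendsto_topTraceDefect (hk : 1 ≤ k) (hA : A.IsSymm) (hB : B.PosSemidef)
    (hBrank : n < B.rank + k) (hθ₀ : 0 ≤ θ) (hθ₁ : θ ≤ 1) (hX : IsSCF hkn A B D θ X Xhat)
    (hacc : Tendsto (fun i => topTraceDefect hkn (E A B D θ (X i)) (Xhat (i + 1))) atTop (𝓝 0)) :
    Tendsto (fun i => topTraceDefect hkn (E A B D θ (X i)) (X i)) atTop (𝓝 0) := by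
  have h := hacc.add (hX.tendsto_trace_sub hk hA hB hBrank hθ₀ hθ₁)
  rw [add_zero] at h
  refine h.congr fun i => ?_
  simp only [topTraceDefect]
  ring

end Iteration

/-! ### Orthogonal factors fixing `XsᵀD`: limit set, maximizers, invariance of `E`. -/

section LimitSet

variable {n k : ℕ}

theorem exists_isSVD_of_posSemidef {S : Matrix (Fin k) (Fin k) ℝ} (hS : S.PosSemidef) :
    ∃ V σ, IsSVD S V σ V := by
  obtain ⟨U, hU, h⟩ := exists_spectral hS.1
  refine ⟨U, eig S, hU, hU, fun j => ?_, eig_antitone hS.1, h⟩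
  have hUU : Uᵀ * U = 1 := hU
  have h1 : Uᵀ * S * U = diagonal (eig S) := by
    calc Uᵀ * S * U = Uᵀ * (U * diagonal (eig S) * Uᵀ) * U := by rw [← h]
      _ = (Uᵀ * U) * diagonal (eig S) * (Uᵀ * U) := by simp only [Matrix.mul_assoc]
      _ = _ := by rw [hUU, Matrix.one_mul, Matrix.mul_one]
  have h2 : (Uᵀ * S * U).PosSemidef := by simpa using hS.conjTranspose_mul_mul_same U
  rw [h1] at h2
  simpa using h2.diag_nonneg (i := j)

theorem IsSVD.lt_rank_iff {S U V : Matrix (Fin k) (Fin k) ℝ} {σ : Fin k → ℝ}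
    (h : IsSVD S U σ V) (j : Fin k) : (j : ℕ) < S.rank ↔ σ j ≠ 0 := by
  have hU : IsUnit U.det :=
    (isUnit_iff_isUnit_det U).mp (IsUnit.of_mul_eq_one_right Uᵀ h.left_mem)
  have hV : IsUnit Vᵀ.det :=
    (isUnit_iff_isUnit_det Vᵀ).mp (IsUnit.of_mul_eq_one V h.right_mem)
  have hr : S.rank = (Finset.univ.filter fun i => σ i ≠ 0).card := by
    rw [h.eq, rank_mul_eq_left_of_isUnit_det _ _ hV, rank_mul_eq_right_of_isUnit_det _ _ hU,
      rank_diagonal, Fintype.card_subtype]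
  constructor
  · intro hj h0
    have hsub : (Finset.univ.filter fun i => σ i ≠ 0) ⊆ Finset.Iio j := by
      intro i hi
      rw [Finset.mem_Iio]
      by_contra hij
      exact (Finset.mem_filter.mp hi).2
        (le_antisymm (h0 ▸ h.antitone (not_lt.mp hij)) (h.nonneg i))
    have := Finset.card_le_card hsub
    rw [Fin.card_Iio] at this
    omega
  · intro h0
    have hsub : Finset.Iic j ⊆ Finset.univ.filter fun i => σ i ≠ 0 := by
      intro i hi
      refine Finset.mem_filter.mpr ⟨Finset.mem_univ _, ?_⟩
      exact (((h.nonneg j).lt_of_ne' h0).trans_le (h.antitone (Finset.mem_Iic.mp hi))).ne'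
    have := Finset.card_le_card hsub
    rw [Fin.card_Iic] at this
    omega

/-- The first `r` columns of `V` span the range of `S`, since the nonzero singular values come
first. -/
theorem IsSVD.mul_eq_self_iff {S V : Matrix (Fin k) (Fin k) ℝ} {σ : Fin k → ℝ}
    (h : IsSVD S V σ V) (Q : Matrix (Fin k) (Fin k) ℝ) :
    Q * S = S ↔ Q * firstCols V S.rank = firstCols V S.rank := by
  have hVV : Vᵀ * V = 1 := h.right_mem
  have hSV : S * V = V * diagonal σ := by
    calc S * V = V * diagonal σ * Vᵀ * V := by rw [← h.eq]
      _ = _ := by rw [Matrix.mul_assoc, hVV, Matrix.mul_one]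
  constructor
  · intro hQ
    have h1 : Q * V * diagonal σ = V * diagonal σ := by
      rw [Matrix.mul_assoc, ← hSV, ← Matrix.mul_assoc, hQ]
    ext i j
    have h2 := congrFun (congrFun h1 i) j.1
    rw [mul_diagonal, mul_diagonal] at h2
    exact mul_right_cancel₀ ((h.lt_rank_iff j.1).mp j.2) h2
  · intro hQ
    have h1 : Q * V * diagonal σ = V * diagonal σ := by
      ext i j
      rw [mul_diagonal, mul_diagonal]
      by_cases hj : σ j = 0
      · rw [hj, mul_zero, mul_zero]
      · have h2 := congrFun (congrFun hQ i) ⟨j, (h.lt_rank_iff j).mpr hj⟩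
        exact congrArg (· * σ j) h2
    calc Q * S = Q * (V * diagonal σ * Vᵀ) := by rw [← h.eq]
      _ = Q * V * diagonal σ * Vᵀ := by simp only [Matrix.mul_assoc]
      _ = S := by rw [h1, ← h.eq]

theorem firstCols_transpose_mul_self {V : Matrix (Fin k) (Fin k) ℝ}
    (hV : V ∈ stiefel (Fin k) (Fin k)) (r : ℕ) : (firstCols V r)ᵀ * firstCols V r = 1 := by
  rw [firstCols, transpose_submatrix, ← submatrix_mul _ _ _ id _ Function.bijective_id,
    show Vᵀ * V = 1 from hV, submatrix_one _ Subtype.val_injective]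

theorem lastCols_transpose_mul_self {V : Matrix (Fin k) (Fin k) ℝ}
    (hV : V ∈ stiefel (Fin k) (Fin k)) (r : ℕ) : (lastCols V r)ᵀ * lastCols V r = 1 := by
  rw [lastCols, transpose_submatrix, ← submatrix_mul _ _ _ id _ Function.bijective_id,
    show Vᵀ * V = 1 from hV, submatrix_one _ Subtype.val_injective]

theorem firstCols_transpose_mul_lastCols {V : Matrix (Fin k) (Fin k) ℝ}
    (hV : V ∈ stiefel (Fin k) (Fin k)) (r : ℕ) : (firstCols V r)ᵀ * lastCols V r = 0 := by
  rw [firstCols, lastCols, transpose_submatrix, ← submatrix_mul _ _ _ id _ Function.bijective_id,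
    show Vᵀ * V = 1 from hV]
  ext i j
  refine one_apply_ne fun h => ?_
  have h1 := i.2
  have h2 := j.2
  rw [h] at h1
  omega

theorem firstCols_add_lastCols {V : Matrix (Fin k) (Fin k) ℝ}
    (hV : V ∈ stiefel (Fin k) (Fin k)) (r : ℕ) :
    firstCols V r * (firstCols V r)ᵀ + lastCols V r * (lastCols V r)ᵀ = 1 := by
  rw [← mul_transpose_eq_one_of_mem_stiefel hV]
  ext i j
  rw [Matrix.add_apply, mul_apply, mul_apply, mul_apply]
  have h1 : _ = ∑ l : {l : Fin k // (l : ℕ) < r}, V i l * V j l :=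
    Finset.sum_subtype (Finset.univ.filter fun l : Fin k => (l : ℕ) < r) (by simp)
      fun l => V i l * V j l
  have h2 : _ = ∑ l : {l : Fin k // r ≤ (l : ℕ)}, V i l * V j l :=
    Finset.sum_subtype (Finset.univ.filter fun l : Fin k => ¬ (l : ℕ) < r) (by simp)
      fun l => V i l * V j l
  have h3 := Finset.sum_filter_add_sum_filter_not Finset.univ (fun l : Fin k => (l : ℕ) < r)
    fun l => V i l * V j l
  rw [h1, h2] at h3
  exact h3

/-- The limit set consists of the matrices `Xs * Q` with `Q` orthogonal and `Q * S = S`. -/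
theorem IsSVD.mem_limitSet_iff {S V : Matrix (Fin k) (Fin k) ℝ} {σ : Fin k → ℝ}
    (h : IsSVD S V σ V) (Xs Y : Matrix (Fin n) (Fin k) ℝ) :
    Y ∈ limitSet Xs V S.rank ↔ ∃ Q ∈ stiefel (Fin k) (Fin k), Q * S = S ∧ Y = Xs * Q := by
  have h11 := firstCols_transpose_mul_self h.left_mem S.rank
  have h22 := lastCols_transpose_mul_self h.left_mem S.rank
  have h12 := firstCols_transpose_mul_lastCols h.left_mem S.rank
  have hsum := firstCols_add_lastCols h.left_mem S.rank
  simp only [h.mul_eq_self_iff]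
  set V₁ := firstCols V S.rank
  set V₂ := lastCols V S.rank
  have h21 : V₂ᵀ * V₁ = 0 := by
    rw [← transpose_transpose (V₂ᵀ * V₁), transpose_mul, transpose_transpose, h12, transpose_zero]
  constructor
  · rintro ⟨W, hW, rfl⟩
    have hWW : Wᵀ * W = 1 := hW
    refine ⟨V₁ * V₁ᵀ + V₂ * W * V₂ᵀ, ?_, ?_, ?_⟩
    · change (V₁ * V₁ᵀ + V₂ * W * V₂ᵀ)ᵀ * (V₁ * V₁ᵀ + V₂ * W * V₂ᵀ) = 1
      calc (V₁ * V₁ᵀ + V₂ * W * V₂ᵀ)ᵀ * (V₁ * V₁ᵀ + V₂ * W * V₂ᵀ)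
          = V₁ * (V₁ᵀ * V₁) * V₁ᵀ + V₁ * (V₁ᵀ * V₂) * W * V₂ᵀ +
            (V₂ * Wᵀ * (V₂ᵀ * V₁) * V₁ᵀ + V₂ * (Wᵀ * (V₂ᵀ * V₂) * W) * V₂ᵀ) := by
            simp only [transpose_add, transpose_mul, transpose_transpose, Matrix.mul_add,
              Matrix.add_mul, Matrix.mul_assoc]
            abel
        _ = 1 := by
            rw [h11, h12, h21, h22, Matrix.mul_one, Matrix.mul_one, hWW, Matrix.mul_one,
              Matrix.mul_zero, Matrix.mul_zero, Matrix.zero_mul, Matrix.zero_mul, Matrix.zero_mul,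
              add_zero, zero_add, hsum]
    · rw [Matrix.add_mul, Matrix.mul_assoc, h11, Matrix.mul_assoc _ V₂ᵀ, h21, Matrix.mul_one,
        Matrix.mul_zero, add_zero]
    · simp only [Matrix.mul_add, Matrix.mul_assoc]
      rfl
  · rintro ⟨Q, hQ, hQV, rfl⟩
    have hQQ : Qᵀ * Q = 1 := hQ
    -- `Qᵀ` fixes `V₁` as well, so `Q` is block diagonal in the basis `V` and `W` is its lower block
    -- `V₂ᵀQV₂`.
    have hQtV : Qᵀ * V₁ = V₁ := by
      conv_lhs => rw [← hQV]
      rw [← Matrix.mul_assoc, hQQ, Matrix.one_mul]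
    have hVQ : V₁ᵀ * Q = V₁ᵀ := by
      rw [← transpose_transpose (V₁ᵀ * Q), transpose_mul, transpose_transpose, hQtV]
    have hQV₂ : Q * V₂ = V₂ * (V₂ᵀ * Q * V₂) := by
      calc Q * V₂ = (V₁ * V₁ᵀ + V₂ * V₂ᵀ) * (Q * V₂) := by rw [hsum, Matrix.one_mul]
        _ = V₁ * (V₁ᵀ * Q * V₂) + V₂ * (V₂ᵀ * Q * V₂) := by
          simp only [Matrix.add_mul, Matrix.mul_assoc]
        _ = _ := by rw [hVQ, h12, Matrix.mul_zero, zero_add]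
    refine ⟨V₂ᵀ * Q * V₂, ?_, ?_⟩
    · change (V₂ᵀ * Q * V₂)ᵀ * (V₂ᵀ * Q * V₂) = 1
      calc (V₂ᵀ * Q * V₂)ᵀ * (V₂ᵀ * Q * V₂) = V₂ᵀ * Qᵀ * (V₂ * (V₂ᵀ * Q * V₂)) := by
            simp only [transpose_mul, transpose_transpose, Matrix.mul_assoc]
        _ = V₂ᵀ * (Qᵀ * Q) * V₂ := by rw [← hQV₂]; simp only [Matrix.mul_assoc]
        _ = 1 := by rw [hQQ, Matrix.mul_one, h22]
    · calc Xs * Q = Xs * (Q * (V₁ * V₁ᵀ + V₂ * V₂ᵀ)) := by rw [hsum, Matrix.mul_one]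
        _ = Xs * (Q * V₁) * V₁ᵀ + Xs * (Q * V₂) * V₂ᵀ := by
          simp only [Matrix.mul_add, Matrix.mul_assoc]
        _ = _ := by rw [hQV, hQV₂]; simp only [Matrix.mul_assoc]; rfl

theorem IsSVD.limitSet_eq_singleton {S V : Matrix (Fin k) (Fin k) ℝ} {σ : Fin k → ℝ}
    (h : IsSVD S V σ V) (hr : S.rank = k) (Xs : Matrix (Fin n) (Fin k) ℝ) :
    limitSet Xs V S.rank = {Xs} := by
  ext Y
  rw [h.mem_limitSet_iff, Set.mem_singleton_iff]
  constructor
  · rintro ⟨Q, hQ, hQS, rfl⟩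
    have hQV : Q * V = V := by
      rw [h.mul_eq_self_iff] at hQS
      ext i j
      exact congrFun (congrFun hQS i) ⟨j, by rw [hr]; exact j.2⟩
    have : Q = 1 := by
      calc Q = Q * V * Vᵀ := by
            rw [Matrix.mul_assoc, mul_transpose_eq_one_of_mem_stiefel h.left_mem, Matrix.mul_one]
        _ = 1 := by rw [hQV, mul_transpose_eq_one_of_mem_stiefel h.left_mem]
    rw [this, Matrix.mul_one]
  · rintro rfl
    exact ⟨1, by simp [stiefel], by simp, by simp⟩

theorem IsSVD.isCompact_limitSet {S V : Matrix (Fin k) (Fin k) ℝ} {σ : Fin k → ℝ}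
    (h : IsSVD S V σ V) (Xs : Matrix (Fin n) (Fin k) ℝ) : IsCompact (limitSet Xs V S.rank) := by
  have e : limitSet Xs V S.rank =
      (fun Q => Xs * Q) '' (stiefel (Fin k) (Fin k) ∩ {Q | Q * S = S}) := by
    ext Y
    rw [h.mem_limitSet_iff]
    constructor
    · rintro ⟨Q, hQ, hQS, rfl⟩
      exact ⟨Q, ⟨hQ, hQS⟩, rfl⟩
    · rintro ⟨Q, ⟨hQ, hQS⟩, rfl⟩
      exact ⟨Q, hQ, hQS, rfl⟩
  rw [e]
  exact (isCompact_stiefel.inter_right (isClosed_eq (by fun_prop) continuous_const)).image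
    (by fun_prop)

theorem IsSVD.self_mem_limitSet {S V : Matrix (Fin k) (Fin k) ℝ} {σ : Fin k → ℝ}
    (h : IsSVD S V σ V) (Xs : Matrix (Fin n) (Fin k) ℝ) : Xs ∈ limitSet Xs V S.rank :=
  (h.mem_limitSet_iff Xs Xs).mpr ⟨1, by simp [stiefel], by simp, by simp⟩

variable {A B : Matrix (Fin n) (Fin n) ℝ} {D : Matrix (Fin n) (Fin k) ℝ}

theorem f_mul_right_orthogonal (θ : ℝ) (X : Matrix (Fin n) (Fin k) ℝ)
    {Q : Matrix (Fin k) (Fin k) ℝ} (hQ : Q ∈ stiefel (Fin k) (Fin k)) :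
    f A B D θ (X * Q) =
      (trace (Xᵀ * A * X) + trace (Qᵀ * (Xᵀ * D))) / trace (Xᵀ * B * X) ^ θ := by
  rw [f, trace_add, trace_mul_right_orthogonal _ _ hQ, trace_mul_right_orthogonal _ _ hQ,
    transpose_mul, Matrix.mul_assoc Qᵀ]

theorem transpose_mul_eq_self {Q S : Matrix (Fin k) (Fin k) ℝ}
    (hQ : Q ∈ stiefel (Fin k) (Fin k)) (h : Q * S = S) : Qᵀ * S = S := by
  conv_lhs => rw [← h]
  rw [← Matrix.mul_assoc, show Qᵀ * Q = 1 from hQ, Matrix.one_mul]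

/-- Along `X * Q` only the term `tr(QᵀXᵀD)` varies; it is at most `tr(XᵀD)`, with equality exactly
when `Q` fixes `XᵀD`. -/
theorem mem_maximizers_iff (hB : B.PosSemidef) (hBrank : n < B.rank + k) (θ : ℝ)
    {X : Matrix (Fin n) (Fin k) ℝ} (hX : X ∈ stiefel (Fin n) (Fin k))
    (hXD : (Xᵀ * D).PosSemidef) (Y : Matrix (Fin n) (Fin k) ℝ) :
    (Y ∈ orthonormalBases X ∧ IsMaxOn (f A B D θ) (orthonormalBases X) Y) ↔
      ∃ Q ∈ stiefel (Fin k) (Fin k), Q * (Xᵀ * D) = Xᵀ * D ∧ Y = X * Q := by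
  have hb := Real.rpow_pos_of_pos (trace_transpose_mul_mul_pos hB hBrank hX) θ
  constructor
  · rintro ⟨hY, hmax⟩
    obtain ⟨Q, hQ, rfl⟩ := (mem_orthonormalBases_iff hX).mp hY
    refine ⟨Q, hQ, mul_eq_self_of_trace_eq hQ hXD
      (le_antisymm (trace_transpose_mul_le hQ hXD) ?_), rfl⟩
    have h1 : (1 : Matrix (Fin k) (Fin k) ℝ) ∈ stiefel (Fin k) (Fin k) := by simp [stiefel]
    have h : f A B D θ (X * (1 : Matrix (Fin k) (Fin k) ℝ)) ≤ f A B D θ (X * Q) :=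
      hmax ((mem_orthonormalBases_iff hX).mpr ⟨1, h1, rfl⟩)
    rw [f_mul_right_orthogonal _ _ hQ, f_mul_right_orthogonal _ _ h1,
      div_le_div_iff_of_pos_right hb, transpose_one, Matrix.one_mul] at h
    linarith
  · rintro ⟨Q, hQ, hQS, rfl⟩
    refine ⟨(mem_orthonormalBases_iff hX).mpr ⟨Q, hQ, rfl⟩, fun Y hY => ?_⟩
    obtain ⟨R, hR, rfl⟩ := (mem_orthonormalBases_iff hX).mp hY
    change f A B D θ (X * R) ≤ f A B D θ (X * Q)
    rw [f_mul_right_orthogonal _ _ hQ, f_mul_right_orthogonal _ _ hR,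
      div_le_div_iff_of_pos_right hb, transpose_mul_eq_self hQ hQS]
    have := trace_transpose_mul_le hR hXD
    linarith

/-- If `X` and `X * Q` both span an invariant subspace of their matrices `E` and `Q` fixes `XᵀD`,
then these matrices agree. -/
theorem E_mul_eq_of_comm (hB : B.PosSemidef) (hBrank : n < B.rank + k) (θ : ℝ)
    {X : Matrix (Fin n) (Fin k) ℝ} (hX : X ∈ stiefel (Fin n) (Fin k))
    {Q : Matrix (Fin k) (Fin k) ℝ} (hQ : Q ∈ stiefel (Fin k) (Fin k))
    (hXD : (Xᵀ * D)ᵀ = Xᵀ * D) (hQS : Q * (Xᵀ * D) = Xᵀ * D)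
    (h₁ : E A B D θ X * (X * Xᵀ) = X * Xᵀ * E A B D θ X)
    (h₂ : E A B D θ (X * Q) * (X * Q * (X * Q)ᵀ) = X * Q * (X * Q)ᵀ * E A B D θ (X * Q)) :
    E A B D θ (X * Q) = E A B D θ X := by
  have hXX : Xᵀ * X = 1 := hX
  have hQQ := mul_transpose_eq_one_of_mem_stiefel hQ
  have hb := Real.rpow_pos_of_pos (trace_transpose_mul_mul_pos hB hBrank hX) θ
  have hf : f A B D 1 (X * Q) = f A B D 1 X := by
    rw [f_mul_right_orthogonal _ _ hQ, transpose_mul_eq_self hQ hQS, f, trace_add]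
  set c := 2 / trace (Xᵀ * B * X) ^ θ with hc
  have hc0 : c ≠ 0 := (div_pos two_pos hb).ne'
  set R := Qᵀ - 1 with hR
  set G := D * R * Xᵀ + X * Rᵀ * Dᵀ with hG
  -- The quadratic traces and `f₁` agree at `X` and `X * Q`, so only the symmetrized `D`-term
  -- changes.
  have hdiff : E A B D θ (X * Q) - E A B D θ X = (c / 2) • G := by
    rw [E, E, hf, trace_mul_right_orthogonal _ _ hQ, ← hc, ← smul_sub]
    have : A + (1 / 2 : ℝ) • (D * (X * Q)ᵀ + X * Q * Dᵀ) - (θ * f A B D 1 X) • B -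
        (A + (1 / 2 : ℝ) • (D * Xᵀ + X * Dᵀ) - (θ * f A B D 1 X) • B) = (1 / 2 : ℝ) • G := by
      rw [hG, hR, transpose_sub, transpose_transpose, transpose_one, transpose_mul]
      simp only [Matrix.mul_sub, Matrix.sub_mul, Matrix.mul_one, Matrix.mul_assoc]
      module
    rw [this, smul_smul]
    congr 1
    ring
  have hPQ : X * Q * (X * Q)ᵀ = X * Xᵀ := by
    rw [transpose_mul, Matrix.mul_assoc, ← Matrix.mul_assoc Q, hQQ, Matrix.one_mul]
  rw [hPQ] at h₂
  have hcomm : G * (X * Xᵀ) = X * Xᵀ * G := by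
    have h3 : (c / 2) • (G * (X * Xᵀ)) = (c / 2) • (X * Xᵀ * G) := by
      rw [← Matrix.smul_mul, ← Matrix.mul_smul, ← hdiff, Matrix.sub_mul, Matrix.mul_sub, h₁, h₂]
    exact smul_right_injective _ (div_ne_zero hc0 two_ne_zero) h3
  have hSR : Xᵀ * D * R = 0 := by
    have : (Xᵀ * D) * Qᵀ = Xᵀ * D := by
      conv_lhs => rw [← hXD]
      rw [← transpose_mul, hQS, hXD]
    rw [hR, Matrix.mul_sub, this, Matrix.mul_one, sub_self]
  have hRS : Rᵀ * Dᵀ * X = 0 := by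
    rw [← transpose_zero, ← hSR]
    simp only [transpose_mul, transpose_transpose, Matrix.mul_assoc]
  -- `G` is now shown to vanish blockwise: this is the block on the span of `X`, commutation with
  -- `XXᵀ` kills the mixed blocks, and on the complement each summand of `G` contains a factor `X`
  -- or `Xᵀ`.
  have hXGX : Xᵀ * G * X = 0 := by
    calc Xᵀ * G * X = (Xᵀ * D * R) * (Xᵀ * X) + (Xᵀ * X) * (Rᵀ * Dᵀ * X) := by
          rw [hG]; simp only [Matrix.mul_add, Matrix.add_mul, Matrix.mul_assoc]
      _ = 0 := by rw [hSR, hRS, Matrix.zero_mul, Matrix.mul_zero, add_zero]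
  have hGX : G * X = 0 := by
    calc G * X = G * (X * Xᵀ) * X := by
          rw [Matrix.mul_assoc, Matrix.mul_assoc X, hXX, Matrix.mul_one]
      _ = X * (Xᵀ * G * X) := by rw [hcomm]; simp only [Matrix.mul_assoc]
      _ = 0 := by rw [hXGX, Matrix.mul_zero]
  have hGP : G * (X * Xᵀ) = 0 := by rw [← Matrix.mul_assoc, hGX, Matrix.zero_mul]
  have hPG : X * Xᵀ * G = 0 := by rw [← hcomm, hGP]
  have hPX : (1 - X * Xᵀ) * X = 0 := by
    rw [Matrix.sub_mul, Matrix.one_mul, Matrix.mul_assoc, hXX, Matrix.mul_one, sub_self]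
  have hXP : Xᵀ * (1 - X * Xᵀ) = 0 := by
    rw [Matrix.mul_sub, Matrix.mul_one, ← Matrix.mul_assoc, hXX, Matrix.one_mul, sub_self]
  have hG0 : G = 0 := by
    calc G = (1 - X * Xᵀ) * G * (1 - X * Xᵀ) := by
          rw [Matrix.sub_mul, Matrix.one_mul, hPG, sub_zero, Matrix.mul_sub, Matrix.mul_one, hGP,
            sub_zero]
      _ = (1 - X * Xᵀ) * D * R * (Xᵀ * (1 - X * Xᵀ)) +
          ((1 - X * Xᵀ) * X) * (Rᵀ * Dᵀ * (1 - X * Xᵀ)) := by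
          conv_lhs => rw [hG]
          rw [Matrix.mul_add, Matrix.add_mul]
          simp only [Matrix.mul_assoc]
      _ = 0 := by rw [hXP, hPX, Matrix.mul_zero, Matrix.zero_mul, add_zero]
  rwa [hG0, smul_zero, sub_eq_zero] at hdiff

end LimitSet

/-! ### Properties inherited by subsequential limits. -/

section Limits

variable {n k : ℕ}

theorem isClosed_setOf_posSemidef : IsClosed {M : Matrix (Fin k) (Fin k) ℝ | M.PosSemidef} := by
  simp only [posSemidef_iff_dotProduct_mulVec, Set.ofPred_and, Set.ofPred_forall]
  refine IsClosed.inter ?_ (isClosed_iInter fun x => ?_)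
  · exact isClosed_eq (by fun_prop) continuous_id
  · exact isClosed_le continuous_const
      (Continuous.dotProduct continuous_const (Continuous.matrix_mulVec continuous_id
        continuous_const))

theorem continuous_trace_transpose_mul_mul_prod :
    Continuous fun p : Matrix (Fin n) (Fin n) ℝ × Matrix (Fin n) (Fin k) ℝ =>
      trace (p.2ᵀ * p.1 * p.2) :=
  Continuous.matrix_trace
    ((continuous_snd.matrix_transpose.matrix_mul continuous_fst).matrix_mul continuous_snd)

theorem tendsto_trace_transpose_mul_mul {M : ℕ → Matrix (Fin n) (Fin n) ℝ}
    {Y : ℕ → Matrix (Fin n) (Fin k) ℝ} {N : Matrix (Fin n) (Fin n) ℝ}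
    {Z : Matrix (Fin n) (Fin k) ℝ} (hMN : Tendsto M atTop (𝓝 N)) (hYZ : Tendsto Y atTop (𝓝 Z)) :
    Tendsto (fun i => trace ((Y i)ᵀ * M i * Y i)) atTop (𝓝 (trace (Zᵀ * N * Z))) := by
  have h := (continuous_trace_transpose_mul_mul_prod (n := n) (k := k)).tendsto (N, Z)
  simpa only [Function.comp_def] using h.comp (hMN.prodMk_nhds hYZ)

/-- Continuity of eigenvalues is avoided: an optimal `W` for the limit `N` is a competitor for every
`M i`, and only traces pass to the limit. -/
theorem topTraceDefect_eq_zero_of_tendsto (hk : 1 ≤ k) (hkn : k ≤ n)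
    {M : ℕ → Matrix (Fin n) (Fin n) ℝ} {Y : ℕ → Matrix (Fin n) (Fin k) ℝ}
    {N : Matrix (Fin n) (Fin n) ℝ} {Z : Matrix (Fin n) (Fin k) ℝ}
    (hM : ∀ i, (M i).IsHermitian) (hN : N.IsHermitian) (hZ : Z ∈ stiefel (Fin n) (Fin k))
    (hMN : Tendsto M atTop (𝓝 N)) (hYZ : Tendsto Y atTop (𝓝 Z))
    (h : Tendsto (fun i => topTraceDefect hkn (M i) (Y i)) atTop (𝓝 0)) :
    topTraceDefect hkn N Z = 0 := by
  refine le_antisymm ?_ (topTraceDefect_nonneg hk hkn hN hZ)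
  obtain ⟨W, hW, hW0⟩ := exists_topTraceDefect_eq_zero hkn hN
  have h1 : Tendsto (fun i => trace (Wᵀ * M i * W)) atTop (𝓝 (trace (Wᵀ * N * W))) :=
    tendsto_trace_transpose_mul_mul hMN tendsto_const_nhds
  have h2 : Tendsto (fun i => trace ((Y i)ᵀ * M i * Y i)) atTop (𝓝 (trace (Zᵀ * N * Z))) :=
    tendsto_trace_transpose_mul_mul hMN hYZ
  have h3 : ∀ i, trace (Wᵀ * M i * W) ≤
      topTraceDefect hkn (M i) (Y i) + trace ((Y i)ᵀ * M i * Y i) := by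
    intro i
    have h4 := topTraceDefect_nonneg hk hkn (hM i) hW
    rw [topTraceDefect] at h4 ⊢
    rw [sub_add_cancel]
    exact sub_nonneg.mp h4
  have h5 : trace (Wᵀ * N * W) ≤ 0 + trace (Zᵀ * N * Z) :=
    le_of_tendsto_of_tendsto' h1 (h.add h2) h3
  rw [zero_add] at h5
  rw [topTraceDefect] at hW0 ⊢
  rw [sub_eq_zero.mp hW0]
  exact sub_nonpos.mpr h5

variable {A B : Matrix (Fin n) (Fin n) ℝ} {D : Matrix (Fin n) (Fin k) ℝ} {θ : ℝ}
  {hkn : k ≤ n} {X Xhat : ℕ → Matrix (Fin n) (Fin k) ℝ} {ψ : ℕ → ℕ}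
  {Z : Matrix (Fin n) (Fin k) ℝ}

theorem IsSCF.mem_of_tendsto (hX : IsSCF hkn A B D θ X Xhat)
    (hZ : Tendsto (fun j => X (ψ j)) atTop (𝓝 Z)) : Z ∈ stiefel (Fin n) (Fin k) :=
  isClosed_stiefel.mem_of_tendsto hZ (Eventually.of_forall fun j => hX.mem (ψ j))

theorem IsSCF.posSemidef_of_tendsto (hX : IsSCF hkn A B D θ X Xhat) (hψ : StrictMono ψ)
    (hZ : Tendsto (fun j => X (ψ j)) atTop (𝓝 Z)) : (Zᵀ * D).PosSemidef := by
  have hcont : Continuous fun Y : Matrix (Fin n) (Fin k) ℝ => Yᵀ * D := by fun_prop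
  refine isClosed_setOf_posSemidef.mem_of_tendsto ((hcont.tendsto Z).comp hZ) ?_
  -- Index `0` is skipped because `(X 0)ᵀD` need not be semidefinite.
  filter_upwards [eventually_ge_atTop 1] with j hj
  have hj' : ψ j ≠ 0 := by have := hψ.le_apply (x := j); omega
  obtain ⟨i, hi⟩ := Nat.exists_eq_succ_of_ne_zero hj'
  simp only [Function.comp_apply, hi]
  exact hX.posSemidef i

theorem IsSCF.tendsto_E (hB : B.PosSemidef) (hBrank : n < B.rank + k)
    (hX : IsSCF hkn A B D θ X Xhat) (hZ : Tendsto (fun j => X (ψ j)) atTop (𝓝 Z)) :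
    Tendsto (fun j => E A B D θ (X (ψ j))) atTop (𝓝 (E A B D θ Z)) :=
  (continuousOn_E (A := A) (D := D) hB hBrank θ Z (hX.mem_of_tendsto hZ)).tendsto.comp
    (tendsto_nhdsWithin_iff.mpr ⟨hZ, Eventually.of_forall fun j => hX.mem (ψ j)⟩)

theorem IsSCF.tendsto_sinThetaDist (hX : IsSCF hkn A B D θ X Xhat)
    (hZ : Tendsto (fun j => X (ψ j)) atTop (𝓝 Z)) {Y : Matrix (Fin n) (Fin k) ℝ}
    (hY : Y ∈ stiefel (Fin n) (Fin k)) :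
    Tendsto (fun j => sinThetaDist (X (ψ j)) Y) atTop (𝓝 (sinThetaDist Z Y)) :=
  (continuousOn_sinThetaDist hY Z (hX.mem_of_tendsto hZ)).tendsto.comp
    (tendsto_nhdsWithin_iff.mpr ⟨hZ, Eventually.of_forall fun j => hX.mem (ψ j)⟩)

theorem IsSCF.isAccSubspace (hX : IsSCF hkn A B D θ X Xhat) (hψ : StrictMono ψ)
    (hZ : Tendsto (fun j => X (ψ j)) atTop (𝓝 Z)) : IsAccSubspace X Z := by
  intro ε hε
  have hZm := hX.mem_of_tendsto hZ
  have h := hX.tendsto_sinThetaDist hZ hZm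
  rw [sinThetaDist_eq_zero_of_proj_eq hZm hZm rfl] at h
  exact hψ.tendsto_atTop.frequently (h.eventually_lt_const hε).frequently

end Limits

/-! ### Trapping of the subspaces and convergence to the limit set. -/

section Convergence

variable {n k : ℕ} {A B : Matrix (Fin n) (Fin n) ℝ} {D : Matrix (Fin n) (Fin k) ℝ} {θ : ℝ}
  {X Xhat : ℕ → Matrix (Fin n) (Fin k) ℝ} {Xs : Matrix (Fin n) (Fin k) ℝ}

/-- Accumulation points with the column space of `Xs` are `Xs * Q` with `Q` fixing `XsᵀD`. -/
theorem IsSCF.exists_eq_mul_of_tendsto {hkn : k ≤ n} (hX : IsSCF hkn A B D θ X Xhat)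
    (hXs : Xs ∈ stiefel (Fin n) (Fin k)) (hXsD : (Xsᵀ * D).PosSemidef)
    {ψ : ℕ → ℕ} (hψ : StrictMono ψ) {Z : Matrix (Fin n) (Fin k) ℝ}
    (hZ : Tendsto (fun j => X (ψ j)) atTop (𝓝 Z)) (h0 : sinThetaDist Z Xs = 0) :
    ∃ Q ∈ stiefel (Fin k) (Fin k), Q * (Xsᵀ * D) = Xsᵀ * D ∧ Z = Xs * Q := by
  obtain ⟨Q, hQ, rfl⟩ := exists_eq_mul_of_sinThetaDist_eq_zero (hX.mem_of_tendsto hZ) hXs h0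
  have h := hX.posSemidef_of_tendsto hψ hZ
  rw [transpose_mul, Matrix.mul_assoc] at h
  exact ⟨Q, hQ, mul_eq_self_of_posSemidef hQ hXsD h, rfl⟩

/-- If the iterates approach the column space of `Xs` along a subsequence, then so do the next
eigenbases. -/
theorem IsSCF.sinThetaDist_hat_eq_zero (hk : 1 ≤ k) (hkn : k < n) (hA : A.IsSymm)
    (hB : B.PosSemidef) (hBrank : n < B.rank + k) (hX : IsSCF hkn.le A B D θ X Xhat)
    (hXs : Xs ∈ stiefel (Fin n) (Fin k)) (hXsD : (Xsᵀ * D).PosSemidef)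
    (hgap : eig (E A B D θ Xs) ⟨k, hkn⟩ < eig (E A B D θ Xs) ⟨k - 1, by omega⟩)
    (hXs0 : topTraceDefect hkn.le (E A B D θ Xs) Xs = 0)
    (hacc : Tendsto (fun i => topTraceDefect hkn.le (E A B D θ (X i)) (Xhat (i + 1))) atTop (𝓝 0))
    (hself : Tendsto (fun i => topTraceDefect hkn.le (E A B D θ (X i)) (X i)) atTop (𝓝 0))
    {ψ : ℕ → ℕ} (hψ : StrictMono ψ) {Z Y : Matrix (Fin n) (Fin k) ℝ}
    (hZ : Tendsto (fun j => X (ψ j)) atTop (𝓝 Z)) (h0 : sinThetaDist Z Xs = 0)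
    (hY : Tendsto (fun j => Xhat (ψ j + 1)) atTop (𝓝 Y)) (hYm : Y ∈ stiefel (Fin n) (Fin k)) :
    sinThetaDist Y Xs = 0 := by
  have hBs : B.IsSymm := by simpa using hB.1
  have hEH : ∀ W, (E A B D θ W).IsHermitian := E_isHermitian hA hBs D θ
  have hZm := hX.mem_of_tendsto hZ
  have hE := hX.tendsto_E hB hBrank hZ
  have hZ0 : topTraceDefect hkn.le (E A B D θ Z) Z = 0 :=
    topTraceDefect_eq_zero_of_tendsto hk hkn.le (fun j => hEH (X (ψ j))) (hEH Z) hZm hE hZ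
      (hself.comp hψ.tendsto_atTop)
  have hY0 : topTraceDefect hkn.le (E A B D θ Z) Y = 0 :=
    topTraceDefect_eq_zero_of_tendsto hk hkn.le (fun j => hEH (X (ψ j))) (hEH Z) hYm hE hY
      (hacc.comp hψ.tendsto_atTop)
  obtain ⟨Q, hQ, hQS, rfl⟩ := hX.exists_eq_mul_of_tendsto hXs hXsD hψ hZ h0
  have hEE : E A B D θ (Xs * Q) = E A B D θ Xs :=
    E_mul_eq_of_comm hB hBrank θ hXs hQ (by simpa using hXsD.1.eq) hQS
      (comm_of_topTraceDefect_eq_zero hk hkn.le (hEH _) hXs hXs0)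
      (comm_of_topTraceDefect_eq_zero hk hkn.le (hEH _) hZm hZ0)
  rw [hEE] at hY0
  exact sinThetaDist_eq_zero_of_proj_eq hYm hXs
    (proj_eq_of_topTraceDefect_eq_zero hk hkn (hEH _) hgap hYm hXs hY0 hXs0)

/-- A sequence that is frequently small and, once small, stays small converges to zero. -/
theorem tendsto_zero_of_frequently_of_eventually_step {a : ℕ → ℝ} (ha : ∀ i, 0 ≤ a i) {δ : ℝ}
    (hδ : 0 < δ) (hfreq : ∀ ε > 0, ∃ᶠ i in atTop, a i < ε)
    (hstep : ∀ ε > 0, ε < δ → ∀ᶠ i in atTop, a i ≤ ε → a (i + 1) < ε) :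
    Tendsto a atTop (𝓝 0) := by
  refine tendsto_order.mpr ⟨fun b hb => Eventually.of_forall fun i => hb.trans_le (ha i),
    fun b hb => ?_⟩
  -- The cap `δ / 2` puts the radius strictly below `δ`, where the step hypothesis applies.
  have hε : 0 < min b (δ / 2) := lt_min hb (half_pos hδ)
  obtain ⟨N, hN⟩ := eventually_atTop.mp
    (hstep _ hε ((min_le_right _ _).trans_lt (half_lt_self hδ)))
  obtain ⟨i, hi, hai⟩ := (frequently_atTop.mp (hfreq _ hε)) N
  refine eventually_atTop.mpr ⟨i, fun j hj => lt_of_lt_of_le ?_ (min_le_left _ (δ / 2))⟩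
  induction j, hj using Nat.le_induction with
  | base => exact hai
  | succ j hj ih => exact hN j (hi.trans hj) ih.le

theorem IsSCF.tendsto_sinThetaDist_zero (hk : 1 ≤ k) (hkn : k < n) (hA : A.IsSymm)
    (hB : B.PosSemidef) (hBrank : n < B.rank + k) (hX : IsSCF hkn.le A B D θ X Xhat)
    (hXs : Xs ∈ stiefel (Fin n) (Fin k)) (hXsD : (Xsᵀ * D).PosSemidef)
    (hiso : IsIsolatedAccSubspace X Xs)
    (hgap : eig (E A B D θ Xs) ⟨k, hkn⟩ < eig (E A B D θ Xs) ⟨k - 1, by omega⟩)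
    (hXs0 : topTraceDefect hkn.le (E A B D θ Xs) Xs = 0)
    (hacc : Tendsto (fun i => topTraceDefect hkn.le (E A B D θ (X i)) (Xhat (i + 1))) atTop (𝓝 0))
    (hself : Tendsto (fun i => topTraceDefect hkn.le (E A B D θ (X i)) (X i)) atTop (𝓝 0)) :
    Tendsto (fun i => sinThetaDist (X i) Xs) atTop (𝓝 0) := by
  obtain ⟨hfreq, δ, hδ, hδ'⟩ := hiso
  refine tendsto_zero_of_frequently_of_eventually_step (fun i => sinThetaDist_nonneg _ _) hδ hfreq
    fun ε hε hεδ => ?_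
  by_contra hcon
  rw [not_eventually] at hcon
  obtain ⟨φ, hφ, hbad⟩ := extraction_of_frequently_atTop hcon
  -- Along the indices that escape the `ε`-ball, both the iterate and the next eigenbasis converge
  -- on a subsequence. Isolation gives `Z` the span of `Xs`, hence so does `Y`, contradicting
  -- distance at least `ε`.
  obtain ⟨⟨Z, Y⟩, ⟨-, hYm⟩, ψ, hψ, hlim⟩ :=
    ((isCompact_stiefel (m := Fin n) (l := Fin k)).prod isCompact_stiefel).tendsto_subseq
      (x := fun j => (X (φ j), Xhat (φ j + 1))) fun j => ⟨hX.mem _, hX.hat_mem _⟩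
  have hmono : StrictMono fun j => φ (ψ j) := hφ.comp hψ
  have hZ : Tendsto (fun j => X (φ (ψ j))) atTop (𝓝 Z) := (continuous_fst.tendsto _).comp hlim
  have hY : Tendsto (fun j => Xhat (φ (ψ j) + 1)) atTop (𝓝 Y) :=
    (continuous_snd.tendsto _).comp hlim
  have hZm := hX.mem_of_tendsto hZ
  have hZε : sinThetaDist Z Xs ≤ ε := by
    refine le_of_tendsto' (hX.tendsto_sinThetaDist hZ hXs) fun j => ?_
    have := hbad (ψ j)
    push Not at this
    exact this.1
  have hYε : ε ≤ sinThetaDist Y Xs := by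
    have h : Tendsto (fun j => sinThetaDist (Xhat (φ (ψ j) + 1)) Xs) atTop
        (𝓝 (sinThetaDist Y Xs)) :=
      (continuousOn_sinThetaDist hXs Y hYm).tendsto.comp
        (tendsto_nhdsWithin_iff.mpr ⟨hY, Eventually.of_forall fun j => hX.hat_mem _⟩)
    refine ge_of_tendsto' h fun j => ?_
    have := hbad (ψ j)
    push Not at this
    obtain ⟨Q, hQ, hQX⟩ := hX.exists_next (φ (ψ j))
    rw [← sinThetaDist_mul_right (hX.hat_mem _) hXs hQ, ← hQX]
    exact this.2
  have hZ0 : sinThetaDist Z Xs = 0 := sinThetaDist_eq_zero_of_colSpace_eq hZm hXs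
    (hδ' Z hZm (hX.isAccSubspace hmono hZ) (hZε.trans_lt hεδ))
  have hY0 := hX.sinThetaDist_hat_eq_zero hk hkn hA hB hBrank hXs hXsD hgap hXs0 hacc hself hmono
    hZ hZ0 hY hYm
  linarith

/-- If the distances stayed at least `b > 0` along a subsequence, compactness would provide an
accumulation point there. Its span is that of `Xs`, so it lies in the limit set, a contradiction. -/
theorem IsSCF.exists_tendsto_dist_limitSet {hkn : k ≤ n} (hX : IsSCF hkn A B D θ X Xhat)
    (hXs : Xs ∈ stiefel (Fin n) (Fin k)) (hXsD : (Xsᵀ * D).PosSemidef)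
    (hconv : Tendsto (fun i => sinThetaDist (X i) Xs) atTop (𝓝 0))
    {V : Matrix (Fin k) (Fin k) ℝ} {σ : Fin k → ℝ} (hV : IsSVD (Xsᵀ * D) V σ V) :
    ∃ m : ℕ → ℝ,
      (∀ i, IsLeast ((fun Y => ‖X i - Y‖) '' limitSet Xs V (Xsᵀ * D).rank) (m i)) ∧
      Tendsto m atTop (𝓝 0) := by
  have hleast : ∀ i, ∃ m, IsLeast ((fun Y => ‖X i - Y‖) '' limitSet Xs V (Xsᵀ * D).rank) m :=
    fun i => ((hV.isCompact_limitSet Xs).image (by fun_prop)).exists_isLeast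
      ⟨_, Xs, hV.self_mem_limitSet Xs, rfl⟩
  choose m hm using hleast
  refine ⟨m, hm, tendsto_order.mpr ⟨fun b hb => Eventually.of_forall fun i => ?_, fun b hb => ?_⟩⟩
  · obtain ⟨Y, -, hY⟩ := (hm i).1
    rw [← hY]
    exact hb.trans_le (norm_nonneg _)
  · by_contra hcon
    rw [not_eventually] at hcon
    obtain ⟨φ, hφ, hbad⟩ := extraction_of_frequently_atTop hcon
    obtain ⟨Z, -, ψ, hψ, hlim⟩ :=
      (isCompact_stiefel (m := Fin n) (l := Fin k)).tendsto_subseq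
        (x := fun j => X (φ j)) fun j => hX.mem _
    have hmono : StrictMono fun j => φ (ψ j) := hφ.comp hψ
    have hZ : Tendsto (fun j => X (φ (ψ j))) atTop (𝓝 Z) := hlim
    have hZ0 : sinThetaDist Z Xs = 0 :=
      tendsto_nhds_unique (hX.tendsto_sinThetaDist hZ hXs) (hconv.comp hmono.tendsto_atTop)
    have hZL : Z ∈ limitSet Xs V (Xsᵀ * D).rank :=
      (hV.mem_limitSet_iff Xs Z).mpr (hX.exists_eq_mul_of_tendsto hXs hXsD hmono hZ hZ0)
    have hnorm : Tendsto (fun j => ‖X (φ (ψ j)) - Z‖) atTop (𝓝 0) :=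
      tendsto_iff_norm_sub_tendsto_zero.mp hZ
    obtain ⟨j, hj⟩ := (hnorm.eventually_lt_const hb).exists
    exact hbad (ψ j) (((hm _).2 ⟨Z, hZL, rfl⟩).trans_lt hj)

end Convergence

end TraceRatio

theorem theorem4p2 {n k : ℕ} (hk : 1 ≤ k) (hkn : k < n)
    (A B : Matrix (Fin n) (Fin n) ℝ) (D : Matrix (Fin n) (Fin k) ℝ) (θ : ℝ)
    (hA : A.IsSymm) (hB : B.PosSemidef) (hBrank : n < B.rank + k)
    (hθ₀ : 0 ≤ θ) (hθ₁ : θ ≤ 1)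
    (X Xhat : ℕ → Matrix (Fin n) (Fin k) ℝ) (hX : IsSCF hkn.le A B D θ X Xhat)
    (hacc : Tendsto (fun i => topTraceDefect hkn.le (E A B D θ (X i)) (Xhat (i + 1)))
      atTop (𝓝 0))
    (Xs : Matrix (Fin n) (Fin k) ℝ) (hXs : MapClusterPt Xs atTop X)
    (hiso : IsIsolatedAccSubspace X Xs)
    (hgap : eig (E A B D θ Xs) ⟨k, hkn⟩ < eig (E A B D θ Xs) ⟨k - 1, by omega⟩) :
    Tendsto (fun i => sinThetaDist (X i) Xs) atTop (𝓝 0) ∧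
    ((Xsᵀ * D).rank = k → Tendsto X atTop (𝓝 Xs)) ∧
    ((Xsᵀ * D).PosSemidef ∧
      (∃ V σ, IsSVD (Xsᵀ * D) V σ V) ∧
      ∀ V σ, IsSVD (Xsᵀ * D) V σ V →
        limitSet Xs V (Xsᵀ * D).rank =
          {Y ∈ orthonormalBases Xs | IsMaxOn (f A B D θ) (orthonormalBases Xs) Y} ∧
        ∃ m : ℕ → ℝ,
          (∀ i, IsLeast ((fun Y => ‖X i - Y‖) '' limitSet Xs V (Xsᵀ * D).rank) (m i)) ∧
          Tendsto m atTop (𝓝 0)) := by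
  have hBs : B.IsSymm := by simpa using hB.1
  have hself := hX.tendsto_topTraceDefect hk hA hB hBrank hθ₀ hθ₁ hacc
  obtain ⟨ψ, hψ, hlim⟩ := hXs.tendsto_subseq
  have hlim' : Tendsto (fun j => X (ψ j)) atTop (𝓝 Xs) := hlim
  have hXsm := hX.mem_of_tendsto hlim'
  have hXsD := hX.posSemidef_of_tendsto hψ hlim'
  have hXs0 : topTraceDefect hkn.le (E A B D θ Xs) Xs = 0 :=
    topTraceDefect_eq_zero_of_tendsto hk hkn.le (fun j => E_isHermitian hA hBs D θ (X (ψ j)))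
      (E_isHermitian hA hBs D θ Xs) hXsm (hX.tendsto_E hB hBrank hlim') hlim'
      (hself.comp hψ.tendsto_atTop)
  have hconv := hX.tendsto_sinThetaDist_zero hk hkn hA hB hBrank hXsm hXsD hiso hgap hXs0 hacc hself
  refine ⟨hconv, fun hr => ?_, hXsD, exists_isSVD_of_posSemidef hXsD, fun V σ hV => ⟨?_, ?_⟩⟩
  · obtain ⟨V, σ, hV⟩ := exists_isSVD_of_posSemidef hXsD
    obtain ⟨m, hm, hm0⟩ := hX.exists_tendsto_dist_limitSet hXsm hXsD hconv hV
    rw [tendsto_iff_norm_sub_tendsto_zero]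
    refine hm0.congr fun i => ?_
    have h := (hm i).1
    rw [hV.limitSet_eq_singleton hr, Set.image_singleton] at h
    exact h
  · ext Y
    rw [hV.mem_limitSet_iff]
    exact (mem_maximizers_iff hB hBrank θ hXsm hXsD Y).symm
  · exact hX.exists_tendsto_dist_limitSet hXsm hXsD hconv hV
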